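/- Let $n\ge 2$ and let $F_n=A_1*\cdots*A_k*B$ ($k\ge 0$), where $A_j$ is free with basis $y^j_1,\dots,y^j_{s(j)}$, $s(j)\ge 1$, and $B$ is free of rank $n-\sum_{j=1}^k s(j)$. Let $m$ be the number of $j$ with $s(j)=1$. Let $R_n(\mathcal A)$ be the relative rose: a central vertex with $n-\sum_j s(j)$ loops and $k$ stems, with a wedge of $s(j)$ circles $C_1^j,\dots,C_{s(j)}^j$ attached at the end of the $j$-th stem; its fundamental group is $F_n$. An $(\mathcal A,n)$-graph is a finite connected graph $\Gamma$ of rank $n$ with all vertices of valence at least $3$ (separating edges are allowed), together with embeddings $l_j:\bigvee_{i=1}^{s(j)}S^1\to\Gamma$, $1\le j\le k$, such that any two of the images (the wedge cycles) meet in at most a point and their dual graph is a forest; the dual graph has one vertex for each wedge cycle, one vertex for each point in which at least two wedge cycles meet, and an edge between a point and each wedge cycle containing it. A marking is a homotopy equivalence $\phi:R_n(\mathcal A)\to\Gamma$ that restricts to $l_j$ on $\bigvee_i C_i^j$ for all $j$. The relative outer space $\mathrm{CV}_n(\mathcal A)$ is the set of marked $(\mathcal A,n)$-graphs with positive edge lengths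 such that each circle $\phi(C_i^j)$ has length $1$ and the total length of the edges outside the wedge cycles is $1$ (no condition if there are no such edges), modulo isometries $h:\Gamma_1\to\Gamma_2$ with $h(\phi_1(C_i^j))=\phi_2(C_i^j)$ for all $i,j$ and $h\circ\phi_1\simeq\phi_2$. The lengths on a fixed marked graph form an open polysimplex (a product of open simplices), and $\mathrm{CV}_n(\mathcal A)$ is the union of these open polysimplices. Let $\mathrm{CV}^{\mathrm{red}}_n(\mathcal A)\subseteq \mathrm{CV}_n(\mathcal A)$ be the reduced relative outer space, which consists of the graphs without separating edges. The dimension of a union of open polysimplices is the maximum of their dimensions. (1) If $n-\sum_{j=1}^k s(j)\ge 1$, then $$\dim \mathrm{CV}_n(\mathcal A)=\dim \mathrm{CV}^{\mathrm{red}}_n(\mathcal A)=3n+3k-3\sum_{j=1}^k s(j)-4-m.$$ (2) If $n=\sum_{j=1}^k s(j)$, then, modulo separating edges, the dimension is $$\dim \mathrm{CV}^{\mathrm{red}}_n(\mathcal A)=3n+2k-3\sum_{j=1}^k s(j)-2-m.$$ -/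

import Mathlib

namespace RelOuter

/-- A finite graph (1-dimensional CW complex). Loops and multiple edges are allowed; every edge
carries an auxiliary orientation. -/
structure FinGraph where
  V : Type
  E : Type
  [finV : Fintype V]
  [finE : Fintype E]
  src : E → V
  tgt : E → V

attribute [instance] FinGraph.finV FinGraph.finE

namespace FinGraph

variable (Γ : FinGraph)

/-- An oriented edge: `(e, true)` is `e` with its orientation, `(e, false)` is its reverse.
Lists of oriented edges are therefore also words representing elements of `FreeGroup Γ.E`. -/
abbrev Dart : Type := Γ.E × Bool

def start (d : Γ.Dart) : Γ.V := if d.2 then Γ.src d.1 else Γ.tgt d.1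

def finish (d : Γ.Dart) : Γ.V := if d.2 then Γ.tgt d.1 else Γ.src d.1

/-- `Γ.IsPath u L v`: the list of oriented edges `L` is an edge path from `u` to `v`. -/
def IsPath : Γ.V → List Γ.Dart → Γ.V → Prop
  | u, [], v => u = v
  | u, d :: L, v => Γ.start d = u ∧ IsPath (Γ.finish d) L v

def Connected : Prop := Nonempty Γ.V ∧ ∀ u v, ∃ L, Γ.IsPath u L v

/-- The valence of a vertex: the number of half edges at it (a loop counts twice). -/
noncomputable def valence (v : Γ.V) : ℕ :=
  {e : Γ.E | Γ.src e = v}.ncard + {e : Γ.E | Γ.tgt e = v}.ncard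

/-- An edge is separating if its endpoints are not joined by a path avoiding it. -/
def IsSeparating (e : Γ.E) : Prop :=
  ¬ ∃ L, Γ.IsPath (Γ.src e) L (Γ.tgt e) ∧ ∀ d ∈ L, d.1 ≠ e

variable {Γ}

theorem IsPath.append {u v w : Γ.V} {L M : List Γ.Dart} (hL : Γ.IsPath u L v)
    (hM : Γ.IsPath v M w) : Γ.IsPath u (L ++ M) w := by
  induction L generalizing u with
  | nil =>
    have h : u = v := hL
    subst h
    exact hM
  | cons d L ih => exact ⟨hL.1, ih hL.2⟩

theorem IsPath.invRev {u v : Γ.V} {L : List Γ.Dart} (hL : Γ.IsPath u L v) :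
    Γ.IsPath v (FreeGroup.invRev L) u := by
  induction L generalizing u with
  | nil => exact Eq.symm hL
  | cons d L ih =>
    have h2 : FreeGroup.invRev (d :: L) = FreeGroup.invRev L ++ [(d.1, !d.2)] := by
      simp [FreeGroup.invRev]
    rw [h2]
    refine (ih hL.2).append ⟨?_, ?_⟩
    · cases h : d.2 <;> simp [start, finish, h]
    · have h3 := hL.1
      cases h : d.2 <;> simpa [IsPath, start, finish, h] using h3

variable (Γ)

/-- The fundamental group of `Γ` at `v`: closed edge paths at `v` modulo insertion and deletion of
backtrackings `d d⁻¹`. Two edge paths with the same endpoints are homotopic relative to the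
endpoints exactly when they have the same free reduction, so this is the subgroup of the free group
on the edges that consists of the classes of closed edge paths at `v`. -/
def pi1 (v : Γ.V) : Subgroup (FreeGroup Γ.E) where
  carrier := {g | ∃ L, Γ.IsPath v L v ∧ FreeGroup.mk L = g}
  mul_mem' := by
    rintro _ _ ⟨L, hL, rfl⟩ ⟨M, hM, rfl⟩
    exact ⟨L ++ M, hL.append hM, by simp⟩
  one_mem' := ⟨[], rfl, rfl⟩
  inv_mem' := by
    rintro _ ⟨L, hL, rfl⟩
    exact ⟨FreeGroup.invRev L, hL.invRev, by simp⟩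

end FinGraph

/-- An `(A_1, …, A_k, n)`-graph, where `A_j` is free of rank `s j`: a finite connected graph of
rank `n`, all of whose vertices have valence at least `3`, with an embedded wedge of `s j` circles
for each `j`, such that two different wedges meet in at most a point and the dual graph of the
wedges is a forest. The circle `(j, i)` is given by the closed edge path `petal j i` at the
basepoint `base j`. -/
structure RelGraph (n : ℕ) {k : ℕ} (s : Fin k → ℕ) extends FinGraph where
  connected : toFinGraph.Connected
  rank_eq : Fintype.card E + 1 = Fintype.card V + n
  three_le_valence : ∀ v, 3 ≤ toFinGraph.valence v
  base : Fin k → V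
  petal : (j : Fin k) → Fin (s j) → List toFinGraph.Dart
  petal_isPath : ∀ j i, toFinGraph.IsPath (base j) (petal j i) (base j)
  petal_ne_nil : ∀ j i, petal j i ≠ []
  /-- Each petal is an embedded circle: no vertex and no edge is passed twice. -/
  petal_vertices_nodup : ∀ j i, ((petal j i).map toFinGraph.start).Nodup
  petal_edges_nodup : ∀ j i, ((petal j i).map Prod.fst).Nodup
  /-- Two petals of the same wedge meet only in the basepoint. -/
  petal_vertices_inter : ∀ j i i', i ≠ i' → ∀ v, v ∈ (petal j i).map toFinGraph.start →
    v ∈ (petal j i').map toFinGraph.start → v = base j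
  petal_edges_disjoint : ∀ j i i', i ≠ i' →
    List.Disjoint ((petal j i).map Prod.fst) ((petal j i').map Prod.fst)
  /-- Two different wedges meet in at most a point. -/
  wedge_edges_disjoint : ∀ j j', j ≠ j' → ∀ i i',
    List.Disjoint ((petal j i).map Prod.fst) ((petal j' i').map Prod.fst)
  wedge_vertices_inter : ∀ j j', j ≠ j' →
    {v : V | (∃ i, v ∈ (petal j i).map toFinGraph.start) ∧
      ∃ i, v ∈ (petal j' i).map toFinGraph.start}.Subsingleton
  /-- The dual graph: one vertex for each wedge, one for each point in which at least two wedges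
  meet, and an edge whenever such a point lies on a wedge. -/
  dual_isAcyclic : (SimpleGraph.fromRel
    (fun (a b : Fin k ⊕ {v : V // ∃ j j', j ≠ j' ∧
        (∃ i, v ∈ (petal j i).map toFinGraph.start) ∧
        ∃ i, v ∈ (petal j' i).map toFinGraph.start}) =>
      ∃ j w, a = Sum.inl j ∧ b = Sum.inr w ∧
        ∃ i, w.1 ∈ (petal j i).map toFinGraph.start)).IsAcyclic

/-- A basis of `F_n = A_1 * ⋯ * A_k * B`: the elements `y_i^j` and the elements `x_i`. -/
abbrev Gen (n : ℕ) {k : ℕ} (s : Fin k → ℕ) : Type :=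
  (Σ j : Fin k, Fin (s j)) ⊕ Fin (n - ∑ j, s j)

/-- The elements of the free group on the edges to which the basis of `F_n` is sent by a map from
the relative rose: `y_i^j` is represented by the `j`-th stem followed by the petal `(j, i)` and the
reversed stem, and `x_i` by the `i`-th loop. -/
def RelGraph.mark {n k : ℕ} {s : Fin k → ℕ} (G : RelGraph n s) (stem : Fin k → List G.Dart)
    (loop : Fin (n - ∑ j, s j) → List G.Dart) : Gen n s → FreeGroup G.E :=
  Sum.elim
    (fun p => FreeGroup.mk (stem p.1) * FreeGroup.mk (G.petal p.1 p.2) *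
      (FreeGroup.mk (stem p.1))⁻¹)
    (fun i => FreeGroup.mk (loop i))

/-- A marked `(A_1, …, A_k, n)`-graph. The marking is a cellular map `φ` from the relative rose
`R_n(A)`, which restricts to the given embeddings of the wedges: it sends the central vertex to
`center`, the stem `f_j` to the edge path `stem j` and the loop `e_i` to the closed edge path
`loop i`. It is a homotopy equivalence: it induces an isomorphism from `F_n`, the fundamental group
of the relative rose, onto the fundamental group of the graph. -/
structure MarkedGraph (n : ℕ) {k : ℕ} (s : Fin k → ℕ) extends RelGraph n s where
  center : V
  stem : Fin k → List toFinGraph.Dart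
  stem_isPath : ∀ j, toFinGraph.IsPath center (stem j) (base j)
  loop : Fin (n - ∑ j, s j) → List toFinGraph.Dart
  loop_isPath : ∀ i, toFinGraph.IsPath center (loop i) center
  mark_injective : Function.Injective (FreeGroup.lift (toRelGraph.mark stem loop))
  mark_range : (FreeGroup.lift (toRelGraph.mark stem loop)).range = toFinGraph.pi1 center

namespace MarkedGraph

variable {n k : ℕ} {s : Fin k → ℕ} (G : MarkedGraph n s)

/-- The edges that do not lie on any wedge cycle. -/
def outside : Set G.E := {e | ∀ j i, e ∉ (G.petal j i).map Prod.fst}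

open Classical in
/-- The open polysimplex of length functions on a marked graph: lengths are positive, each circle
`φ(C_i^j)` has length `1`, and the relative volume, i.e. the total length of the edges outside the
wedge cycles, is `1` (no condition if there are no such edges). -/
def polysimplex : Set (G.E → ℝ) :=
  {l | (∀ e, 0 < l e) ∧ (∀ j i, ((G.petal j i).map fun d => l d.1).sum = 1) ∧
    (G.outside.Nonempty → ∑ e with e ∈ G.outside, l e = 1)}

/-- The dimension of the open polysimplex, as the dimension of its affine hull. -/
noncomputable def polysimplexDim : ℕ := Module.finrank ℝ (vectorSpan ℝ G.polysimplex)

end MarkedGraph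

/-- A marked metric graph, normalized as required for a point of the relative outer space. -/
structure MarkedMetricGraph (n : ℕ) {k : ℕ} (s : Fin k → ℕ) extends MarkedGraph n s where
  length : E → ℝ
  length_mem : length ∈ toMarkedGraph.polysimplex

/-- The equivalence of marked metric graphs: there is an isometry `h` (a graph isomorphism
preserving lengths; `flip e` records whether it reverses the auxiliary orientation of `e`) that
carries each circle `φ₁(C_i^j)` to `φ₂(C_i^j)` and such that `h ∘ φ₁` is homotopic to `φ₂`. The
path `t` is the track of the central vertex under the homotopy. -/
def MarkedMetricGraph.Equivalent {n k : ℕ} {s : Fin k → ℕ} (G H : MarkedMetricGraph n s) : Prop :=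
  ∃ (hV : G.V ≃ H.V) (hE : G.E ≃ H.E) (flip : G.E → Bool),
    (∀ e, H.start (hE e, !flip e) = hV (G.src e) ∧ H.finish (hE e, !flip e) = hV (G.tgt e)) ∧
    (∀ e, H.length (hE e) = G.length e) ∧
    (∀ j i e, hE e ∈ (H.petal j i).map Prod.fst ↔ e ∈ (G.petal j i).map Prod.fst) ∧
    ∃ t, H.IsPath (hV G.center) t H.center ∧
      ∀ x, FreeGroup.lift (fun e => FreeGroup.mk [(hE e, !flip e)]) (G.mark G.stem G.loop x) =
        FreeGroup.mk t * H.mark H.stem H.loop x * (FreeGroup.mk t)⁻¹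

/-- The relative outer space `CV_n(A_1, …, A_k)`, where `A_j` has rank `s j`. -/
def RelOuterSpace (n : ℕ) {k : ℕ} (s : Fin k → ℕ) : Type 1 :=
  Quot (MarkedMetricGraph.Equivalent (n := n) (s := s))

namespace RelOuterSpace

variable {n k : ℕ} {s : Fin k → ℕ}

/-- The reduced part of the relative outer space: the graphs without separating edges. -/
def reduced (n : ℕ) {k : ℕ} (s : Fin k → ℕ) : Set (RelOuterSpace n s) :=
  {x | ∃ G : MarkedMetricGraph n s, (∀ e, ¬ G.IsSeparating e) ∧ x = Quot.mk _ G}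

/-- The open polysimplex in the relative outer space obtained by varying the lengths of the edges
of a marked graph. -/
def openPolysimplex (G : MarkedGraph n s) : Set (RelOuterSpace n s) :=
  {x | ∃ (l : G.E → ℝ) (hl : l ∈ G.polysimplex), x = Quot.mk _ ⟨G, l, hl⟩}

/-- The dimension of a union `X` of open polysimplices of the relative outer space: the supremum
of their dimensions. -/
noncomputable def dim (X : Set (RelOuterSpace n s)) : WithBot ℕ∞ :=
  ⨆ (G : MarkedGraph n s) (_ : openPolysimplex G ⊆ X), ((G.polysimplexDim : ℕ∞) : WithBot ℕ∞)

end RelOuterSpace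

end RelOuter

/-!
The fibres of the constraints on the lengths are disjoint, so the dimension of the polysimplex of a
marked graph `G` is the number of its edges, minus the number `∑ s j` of circles, minus one more if
there are edges outside the wedges. As the rank is fixed, the task is to maximize the number of
vertices.

*Upper bounds.* If there are edges outside the wedges, sum the valences: a vertex which is the
basepoint of the wedges in a set `J` has valence at least `3 + ∑ j ∈ J, (2 * s j - 3)`, with
truncated subtraction. If there are no such edges, then every vertex of valence at least three is
the basepoint of a wedge of at least two circles or lies on two wedges, and as the dual graph is a
forest, there are at most `k - 1` vertices of the second kind. For `∑ s j < n` there is an edge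
outside the wedges because a union of wedges with acyclic dual graph has rank at most `∑ s j`. For
`n = ∑ s j` the circles span the cycle space of `G`, so an edge outside of them separates.

*Lower bounds.* The bounds are attained by graphs without separating edges. For
`∑ s j < n` these are necklaces, in which wedges and digons alternate with single edges along a
ring. For `n = ∑ s j` every wedge but one is attached to its own point of a circle of the remaining
one. A spanning tree that contains all edges but one of every circle shows that these graphs carry
a marking: collapsing it turns the circles into members of a basis of the fundamental group.
-/

namespace RelOuter

section Polysimplex

theorem exists_pos_add_smul_pos {E : Type*} [Finite E] {l : E → ℝ} (hl : ∀ e, 0 < l e) (v : E → ℝ) :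
    ∃ ε : ℝ, 0 < ε ∧ ∀ e, 0 < (l + ε • v) e := by
  have hnear (e : E) : ∀ᶠ ε in nhdsWithin (0 : ℝ) (Set.Ioi 0), 0 < (l + ε • v) e := by
    have hcont : Continuous fun ε : ℝ => (l + ε • v) e := by
      simp only [Pi.add_apply, Pi.smul_apply, smul_eq_mul]
      fun_prop
    exact ((hcont.tendsto 0).eventually (lt_mem_nhds (by simpa using hl e))).filter_mono
      nhdsWithin_le_nhds
  obtain ⟨ε, hε, hpos⟩ := ((Filter.eventually_all.mpr hnear).and self_mem_nhdsWithin).exists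
  exact ⟨ε, hpos, hε⟩

theorem vectorSpan_pos_inter_fiber {E M : Type*} [Finite E] [AddCommGroup M] [Module ℝ M]
    (C : (E → ℝ) →ₗ[ℝ] M) {l₀ : E → ℝ} (hl₀ : ∀ e, 0 < l₀ e) :
    vectorSpan ℝ {l : E → ℝ | (∀ e, 0 < l e) ∧ C l = C l₀} = LinearMap.ker C := by
  apply le_antisymm
  · rw [vectorSpan_def, Submodule.span_le]
    rintro _ ⟨l, hl, l', hl', rfl⟩
    simp [hl.2, hl'.2]
  · intro v hv
    obtain ⟨ε, hε, hpos⟩ := exists_pos_add_smul_pos hl₀ v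
    have hmem : l₀ + ε • v ∈ {l : E → ℝ | (∀ e, 0 < l e) ∧ C l = C l₀} :=
      ⟨hpos, by rw [map_add, map_smul, LinearMap.mem_ker.mp hv, smul_zero, add_zero]⟩
    have hdiff := vsub_mem_vectorSpan ℝ hmem ⟨hl₀, rfl⟩
    rw [vsub_eq_sub, add_sub_cancel_left] at hdiff
    exact (Submodule.smul_mem_iff _ hε.ne').mp hdiff

variable {E B : Type*} [Fintype E]

/-- The linear map that sums a function on `E` over the fibres of `f : E → B`. The normalizations
of the lengths in a polysimplex prescribe its value. -/
def fiberSum [DecidableEq B] (f : E → B) : (E → ℝ) →ₗ[ℝ] (B → ℝ) where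
  toFun l b := ∑ e with f e = b, l e
  map_add' l l' := by ext b; simp [Finset.sum_add_distrib]
  map_smul' c l := by ext b; simp [Finset.mul_sum]

theorem fiberSum_apply [DecidableEq B] (f : E → B) (l : E → ℝ) (b : B) :
    fiberSum f l b = ∑ e with f e = b, l e := rfl

theorem fiberSum_inv_card_fiber_mul [DecidableEq B] {f : E → B} (hf : f.Surjective) (y : B → ℝ) :
    fiberSum f (fun e => ((Finset.univ.filter fun e' => f e' = f e).card : ℝ)⁻¹ * y (f e)) = y := by
  ext b
  have hb : ((Finset.univ.filter fun e => f e = b).card : ℝ) ≠ 0 := by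
    obtain ⟨e, he⟩ := hf b
    exact Nat.cast_ne_zero.mpr (Finset.card_ne_zero_of_mem (by simpa using he : e ∈ _))
  calc ∑ e with f e = b, ((Finset.univ.filter fun e' => f e' = f e).card : ℝ)⁻¹ * y (f e)
      = ∑ e with f e = b, ((Finset.univ.filter fun e' => f e' = b).card : ℝ)⁻¹ * y b :=
        Finset.sum_congr rfl fun e he => by rw [(Finset.mem_filter.mp he).2]
    _ = y b := by rw [Finset.sum_const, nsmul_eq_mul, mul_inv_cancel_left₀ hb]

theorem fiberSum_surjective [DecidableEq B] {f : E → B} (hf : f.Surjective) :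
    Function.Surjective (fiberSum f) :=
  fun y => ⟨_, fiberSum_inv_card_fiber_mul hf y⟩

theorem exists_pos_fiberSum_eq [DecidableEq B] {f : E → B} (hf : f.Surjective) {y : B → ℝ}
    (hy : ∀ b, 0 < y b) : ∃ l : E → ℝ, (∀ e, 0 < l e) ∧ fiberSum f l = y := by
  refine ⟨_, fun e => ?_, fiberSum_inv_card_fiber_mul hf y⟩
  have hcard : 0 < (Finset.univ.filter fun e' => f e' = f e).card :=
    Finset.card_pos.mpr ⟨e, by simp⟩
  exact mul_pos (inv_pos.mpr (Nat.cast_pos.mpr hcard)) (hy _)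

variable [Fintype B] [DecidableEq B]

theorem finrank_ker_fiberSum_add_card {f : E → B} (hf : f.Surjective) :
    Module.finrank ℝ (LinearMap.ker (fiberSum f)) + Fintype.card B = Fintype.card E := by
  have hrank := (fiberSum f).finrank_range_add_finrank_ker
  rw [LinearMap.range_eq_top.mpr (fiberSum_surjective hf), finrank_top,
    Module.finrank_fintype_fun_eq_card, Module.finrank_fintype_fun_eq_card] at hrank
  lia

theorem finrank_vectorSpan_fiberSum_eq_add_card {f : E → B} (hf : f.Surjective) {y : B → ℝ}
    (hy : ∀ b, 0 < y b) :
    Module.finrank ℝ (vectorSpan ℝ {l : E → ℝ | (∀ e, 0 < l e) ∧ fiberSum f l = y}) +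
      Fintype.card B = Fintype.card E := by
  obtain ⟨l, hl, rfl⟩ := exists_pos_fiberSum_eq hf hy
  rw [vectorSpan_pos_inter_fiber _ hl]
  exact finrank_ker_fiberSum_add_card hf

end Polysimplex

namespace FinGraph

variable {Γ Δ : FinGraph}

/-- The reversed oriented edge. -/
def rev (d : Γ.Dart) : Γ.Dart := (d.1, !d.2)

@[simp] theorem rev_fst (d : Γ.Dart) : (rev d).1 = d.1 := rfl

@[simp] theorem rev_rev (d : Γ.Dart) : rev (rev d) = d := by simp [rev]

@[simp] theorem start_rev (d : Γ.Dart) : Γ.start (rev d) = Γ.finish d := by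
  cases h : d.2 <;> simp [start, finish, rev, h]

@[simp] theorem finish_rev (d : Γ.Dart) : Γ.finish (rev d) = Γ.start d := by
  cases h : d.2 <;> simp [start, finish, rev, h]

theorem rev_ne (d : Γ.Dart) : rev d ≠ d := fun h => by
  simpa [rev] using congrArg Prod.snd h

theorem eq_or_eq_rev {d d' : Γ.Dart} (h : d.1 = d'.1) : d' = d ∨ d' = rev d := by
  obtain ⟨e, b⟩ := d
  obtain ⟨e', b'⟩ := d'
  obtain rfl : e = e' := h
  cases b <;> cases b' <;> simp [rev]

theorem map_fst_invRev (L : List Γ.Dart) :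
    (FreeGroup.invRev L).map Prod.fst = (L.map Prod.fst).reverse := by
  simp [FreeGroup.invRev, List.map_reverse, Function.comp_def]

theorem IsPath.of_append {u w : Γ.V} {L M : List Γ.Dart} (h : Γ.IsPath u (L ++ M) w) :
    ∃ v, Γ.IsPath u L v ∧ Γ.IsPath v M w := by
  induction L generalizing u with
  | nil => exact ⟨u, rfl, h⟩
  | cons d L ih =>
    obtain ⟨v, hL, hM⟩ := ih h.2
    exact ⟨v, ⟨h.1, hL⟩, hM⟩

theorem isPath_singleton (d : Γ.Dart) : Γ.IsPath (Γ.start d) [d] (Γ.finish d) := ⟨rfl, rfl⟩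

theorem isPath_ofFn {m : ℕ} {d : Fin m → Γ.Dart} {f : Fin (m + 1) → Γ.V}
    (hstart : ∀ i, Γ.start (d i) = f i.castSucc) (hfinish : ∀ i, Γ.finish (d i) = f i.succ) :
    Γ.IsPath (f 0) (List.ofFn d) (f (Fin.last m)) := by
  induction m with
  | zero => simp [IsPath]
  | succ m ih =>
    rw [List.ofFn_succ]
    refine ⟨hstart 0, ?_⟩
    rw [hfinish 0]
    exact ih (f := fun i => f i.succ) (fun i => hstart i.succ) fun i => hfinish i.succ

theorem IsPath.map {fV : Γ.V → Δ.V} {φ : Γ.Dart → Δ.Dart}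
    (hstart : ∀ d, Δ.start (φ d) = fV (Γ.start d))
    (hfinish : ∀ d, Δ.finish (φ d) = fV (Γ.finish d)) {u v : Γ.V} {L : List Γ.Dart}
    (h : Γ.IsPath u L v) : Δ.IsPath (fV u) (L.map φ) (fV v) := by
  induction L generalizing u with
  | nil => exact congrArg fV h
  | cons d L ih => exact ⟨(hstart d).trans (congrArg fV h.1), by rw [hfinish]; exact ih h.2⟩

theorem IsPath.start_head {u v : Γ.V} {L : List Γ.Dart} (h : Γ.IsPath u L v) (hL : L ≠ []) :
    Γ.start (L.head hL) = u := by
  obtain ⟨d, L, rfl⟩ := List.exists_cons_of_ne_nil hL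
  exact h.1

theorem IsPath.finish_getLast {u v : Γ.V} {L : List Γ.Dart} (h : Γ.IsPath u L v) (hL : L ≠ []) :
    Γ.finish (L.getLast hL) = v := by
  rw [← List.dropLast_append_getLast hL] at h
  obtain ⟨_, -, -, hlast⟩ := h.of_append
  exact hlast

theorem IsPath.map_start_append {u v : Γ.V} {L : List Γ.Dart} (h : Γ.IsPath u L v) :
    L.map Γ.start ++ [v] = u :: L.map Γ.finish := by
  induction L generalizing u with
  | nil => simp [show u = v from h]
  | cons d L ih => simp [ih h.2, h.1]

theorem IsPath.map_finish_perm {v : Γ.V} {L : List Γ.Dart} (h : Γ.IsPath v L v) :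
    (L.map Γ.finish).Perm (L.map Γ.start) := by
  have hcons : (v :: L.map Γ.finish).Perm (v :: L.map Γ.start) := by
    rw [← h.map_start_append]
    exact List.perm_append_singleton _ _
  exact hcons.cons_inv

theorem IsPath.base_mem {v : Γ.V} {L : List Γ.Dart} (h : Γ.IsPath v L v) (hL : L ≠ []) :
    v ∈ L.map Γ.start :=
  List.mem_map.mpr ⟨_, List.head_mem hL, h.start_head hL⟩

theorem mem_or_rev_mem_of_fst_mem {L : List Γ.Dart} {d : Γ.Dart} (h : d.1 ∈ L.map Prod.fst) :
    d ∈ L ∨ rev d ∈ L := by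
  obtain ⟨d', hd', hfst⟩ := List.mem_map.mp h
  rcases eq_or_eq_rev hfst.symm with rfl | rfl
  · exact Or.inl hd'
  · exact Or.inr hd'

theorem IsPath.start_mem_of_fst_mem {v : Γ.V} {L : List Γ.Dart} (hL : Γ.IsPath v L v)
    {d : Γ.Dart} (h : d.1 ∈ L.map Prod.fst) : Γ.start d ∈ L.map Γ.start := by
  rcases mem_or_rev_mem_of_fst_mem h with h | h
  · exact List.mem_map_of_mem h
  · rw [← hL.map_finish_perm.mem_iff, ← finish_rev]
    exact List.mem_map_of_mem h

theorem not_isSeparating_iff_exists_isPath {d : Γ.Dart} : ¬ Γ.IsSeparating d.1 ↔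
    ∃ L, Γ.IsPath (Γ.start d) L (Γ.finish d) ∧ d.1 ∉ L.map Prod.fst := by
  have avoids {L : List Γ.Dart} : (∀ d' ∈ L, d'.1 ≠ d.1) ↔ d.1 ∉ L.map Prod.fst := by
    simp only [List.mem_map, not_exists, not_and, ne_eq]
  rw [IsSeparating, not_not]
  simp only [avoids]
  obtain ⟨e, _ | _⟩ := d
  · refine ⟨?_, ?_⟩ <;>
    · rintro ⟨L, hL, he⟩
      exact ⟨_, hL.invRev, by rwa [map_fst_invRev, List.mem_reverse]⟩
  · rfl

theorem not_isSeparating_of_mem {v : Γ.V} {L : List Γ.Dart} (h : Γ.IsPath v L v)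
    (hnodup : (L.map Prod.fst).Nodup) {e : Γ.E} (he : e ∈ L.map Prod.fst) :
    ¬ Γ.IsSeparating e := by
  obtain ⟨d, hd, rfl⟩ := List.mem_map.mp he
  obtain ⟨A, B, rfl⟩ := List.append_of_mem hd
  obtain ⟨_, hA, rfl, hB⟩ := h.of_append
  refine not_isSeparating_iff_exists_isPath.mpr ⟨FreeGroup.invRev (B ++ A), ?_, ?_⟩
  · exact (hB.append hA).invRev
  · rw [List.map_append, List.map_cons, List.nodup_middle, List.nodup_cons] at hnodup
    simpa [map_fst_invRev, and_comm, or_comm] using hnodup.1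

theorem not_isSeparating_of_map {fV : Γ.V → Δ.V} {φ : Γ.Dart → Δ.Dart}
    (hstart : ∀ d, Δ.start (φ d) = fV (Γ.start d))
    (hfinish : ∀ d, Δ.finish (φ d) = fV (Γ.finish d)) {d : Γ.Dart}
    (hφ : ∀ d', (φ d').1 = (φ d).1 → d'.1 = d.1) (hd : ¬ Γ.IsSeparating d.1) :
    ¬ Δ.IsSeparating (φ d).1 := by
  obtain ⟨L, hL, hdL⟩ := not_isSeparating_iff_exists_isPath.mp hd
  refine not_isSeparating_iff_exists_isPath.mpr ⟨L.map φ, ?_, ?_⟩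
  · rw [hstart, hfinish]
    exact hL.map hstart hfinish
  · rw [List.map_map, List.mem_map]
    rintro ⟨d', hd', heq⟩
    exact hdL (List.mem_map.mpr ⟨d', hd', hφ d' heq⟩)

theorem forall_not_isSeparating_of_equiv {fV : Γ.V → Δ.V} {φ : Γ.Dart ≃ Δ.Dart}
    (hstart : ∀ d, Δ.start (φ d) = fV (Γ.start d)) (hrev : ∀ d, φ (rev d) = rev (φ d))
    (h : ∀ e, ¬ Γ.IsSeparating e) (e : Δ.E) : ¬ Δ.IsSeparating e := by
  have hfinish (d : Γ.Dart) : Δ.finish (φ d) = fV (Γ.finish d) := by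
    rw [← start_rev, ← hrev, hstart, start_rev]
  have hfst (d d' : Γ.Dart) (heq : (φ d').1 = (φ d).1) : d'.1 = d.1 := by
    rcases eq_or_eq_rev heq with heq | heq
    · rw [φ.injective heq]
    · rw [φ.injective (heq.trans (hrev d').symm), rev_fst]
  have he := not_isSeparating_of_map hstart hfinish (hfst (φ.symm (e, true))) (h _)
  rwa [φ.apply_symm_apply] at he

theorem valence_eq_card_filter_start [DecidableEq Γ.V] (v : Γ.V) :
    Γ.valence v = (Finset.univ.filter fun d : Γ.Dart => Γ.start d = v).card := by
  classical
  rw [Finset.card_filter, Fintype.sum_prod_type, valence, Set.ncard_eq_toFinset_card',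
    Set.ncard_eq_toFinset_card', Set.toFinset_ofPred, Set.toFinset_ofPred, Finset.card_filter,
    Finset.card_filter, ← Finset.sum_add_distrib]
  refine Finset.sum_congr rfl fun e _ => ?_
  rw [Fintype.sum_bool]
  rfl

theorem sum_valence : ∑ v, Γ.valence v = 2 * Fintype.card Γ.E := by
  classical
  simp_rw [valence_eq_card_filter_start]
  rw [← Finset.card_eq_sum_card_fiberwise (f := Γ.start) (t := Finset.univ) (by simp)]
  simp [mul_comm]

theorem card_le_valence {v : Γ.V} {S : Finset Γ.Dart} (h : ∀ d ∈ S, Γ.start d = v) :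
    S.card ≤ Γ.valence v := by
  classical
  rw [valence_eq_card_filter_start]
  exact Finset.card_le_card fun d hd => by simpa using h d hd

theorem three_le_valence {v : Γ.V} {d₁ d₂ d₃ : Γ.Dart} (h₁ : Γ.start d₁ = v)
    (h₂ : Γ.start d₂ = v) (h₃ : Γ.start d₃ = v) (h₁₂ : d₁ ≠ d₂) (h₁₃ : d₁ ≠ d₃)
    (h₂₃ : d₂ ≠ d₃) : 3 ≤ Γ.valence v := by
  classical
  rw [← Finset.card_eq_three.mpr ⟨d₁, d₂, d₃, h₁₂, h₁₃, h₂₃, rfl⟩]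
  apply card_le_valence
  simp [h₁, h₂, h₃]

theorem IsPath.three_le_valence {u v : Γ.V} {L : List Γ.Dart} (hL : Γ.IsPath u L u)
    (hnodup : (L.map Prod.fst).Nodup) (hv : v ∈ L.map Γ.start) {d : Γ.Dart} (hd : Γ.start d = v)
    (hdL : d.1 ∉ L.map Prod.fst) : 3 ≤ Γ.valence v := by
  obtain ⟨dOut, hOut, hOut_start⟩ := List.mem_map.mp hv
  obtain ⟨dIn, hIn, hIn_finish⟩ := List.mem_map.mp (hL.map_finish_perm.mem_iff.mpr hv)
  refine FinGraph.three_le_valence hOut_start ((start_rev dIn).trans hIn_finish) hd ?_ ?_ ?_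
  · intro h
    have hfst : dOut.1 = (rev dIn).1 := congrArg Prod.fst h
    exact rev_ne dIn (h.symm.trans (List.inj_on_of_nodup_map hnodup hOut hIn hfst))
  · exact fun h => hdL (h ▸ List.mem_map_of_mem hOut)
  · exact fun h => hdL (h ▸ List.mem_map.mpr ⟨dIn, hIn, rfl⟩)

theorem IsPath.valence_le_two {u : Γ.V} {L : List Γ.Dart} (hL : Γ.IsPath u L u)
    (hnodup : (L.map Γ.start).Nodup) {v : Γ.V}
    (hv : ∀ d : Γ.Dart, Γ.start d = v → d.1 ∈ L.map Prod.fst) : Γ.valence v ≤ 2 := by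
  classical
  have hout : (L.toFinset.filter fun d => Γ.start d = v).card ≤ 1 :=
    Finset.card_le_one.mpr fun d hd d' hd' => by
      simp only [Finset.mem_filter, List.mem_toFinset] at hd hd'
      exact List.inj_on_of_nodup_map hnodup hd.1 hd'.1 (hd.2.trans hd'.2.symm)
  have hin : (L.toFinset.filter fun d => Γ.finish d = v).card ≤ 1 :=
    Finset.card_le_one.mpr fun d hd d' hd' => by
      simp only [Finset.mem_filter, List.mem_toFinset] at hd hd'
      exact List.inj_on_of_nodup_map (hL.map_finish_perm.nodup_iff.mpr hnodup) hd.1 hd'.1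
        (hd.2.trans hd'.2.symm)
  rw [valence_eq_card_filter_start]
  calc (Finset.univ.filter fun d : Γ.Dart => Γ.start d = v).card
      ≤ ((L.toFinset.filter fun d => Γ.start d = v) ∪
          (L.toFinset.filter fun d => Γ.finish d = v).image rev).card :=
        Finset.card_le_card fun d hd => by
          have hd : Γ.start d = v := by simpa using hd
          simp only [Finset.mem_union, Finset.mem_filter, List.mem_toFinset, Finset.mem_image]
          exact (mem_or_rev_mem_of_fst_mem (hv d hd)).imp (fun h => ⟨h, hd⟩)
            fun h => ⟨rev d, ⟨h, by rw [finish_rev, hd]⟩, rev_rev d⟩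
    _ ≤ 2 := by
        have himage := Finset.card_image_le (s := L.toFinset.filter fun d => Γ.finish d = v)
          (f := rev)
        exact (Finset.card_union_le _ _).trans (by lia)

section Homology

/-- The simplicial coboundary `C⁰(Γ; ℝ) → C¹(Γ; ℝ)`. -/
def coboundary (Γ : FinGraph) : (Γ.V → ℝ) →ₗ[ℝ] (Γ.E → ℝ) where
  toFun f e := f (Γ.tgt e) - f (Γ.src e)
  map_add' f g := by
    ext e
    simp only [Pi.add_apply]
    ring
  map_smul' c f := by
    ext e
    simp only [Pi.smul_apply, smul_eq_mul, RingHom.id_apply]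
    ring

/-- The integral of real cochains along an edge path, as a linear functional. The integrals along
closed paths stand for the elements of the first homology group of `Γ`. -/
noncomputable def integral : List Γ.Dart → Module.Dual ℝ (Γ.E → ℝ)
  | [] => 0
  | d :: L => (if d.2 then (1 : ℝ) else -1) • LinearMap.proj d.1 + integral L

theorem integral_cons (d : Γ.Dart) (L : List Γ.Dart) (l : Γ.E → ℝ) :
    integral (d :: L) l = (if d.2 then (1 : ℝ) else -1) * l d.1 + integral L l := rfl

theorem integral_append (L M : List Γ.Dart) : integral (L ++ M) = integral L + integral M := by
  induction L with
  | nil => exact (zero_add _).symm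
  | cons d L ih =>
    ext
    simp [integral, ih, add_assoc]

theorem integral_single_of_notMem [DecidableEq Γ.E] {L : List Γ.Dart} {e : Γ.E}
    (h : e ∉ L.map Prod.fst) : integral L (Pi.single e 1) = 0 := by
  induction L with
  | nil => rfl
  | cons d L ih =>
    rw [List.map_cons, List.mem_cons, not_or] at h
    rw [integral_cons, ih h.2, Pi.single_eq_of_ne' h.1, mul_zero, add_zero]

theorem integral_single_ne_zero [DecidableEq Γ.E] {L : List Γ.Dart} {e : Γ.E}
    (hnodup : (L.map Prod.fst).Nodup) (h : e ∈ L.map Prod.fst) :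
    integral L (Pi.single e 1) ≠ 0 := by
  obtain ⟨d, hd, rfl⟩ := List.mem_map.mp h
  obtain ⟨A, B, rfl⟩ := List.append_of_mem hd
  rw [List.map_append, List.map_cons, List.nodup_middle, List.nodup_cons, List.mem_append,
    not_or] at hnodup
  rw [integral_append, LinearMap.add_apply, integral_cons, integral_single_of_notMem hnodup.1.1,
    integral_single_of_notMem hnodup.1.2, Pi.single_eq_same]
  split_ifs <;> norm_num

theorem IsPath.integral_coboundary {u v : Γ.V} {L : List Γ.Dart} (h : Γ.IsPath u L v)
    (f : Γ.V → ℝ) : integral L (Γ.coboundary f) = f v - f u := by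
  induction L generalizing u with
  | nil =>
    obtain rfl : u = v := h
    exact (sub_self _).symm
  | cons d L ih =>
    obtain ⟨rfl, hL⟩ := h
    rw [integral_cons, ih hL]
    obtain ⟨e, _ | _⟩ := d <;> simp [coboundary, start, finish]

theorem Connected.card_le_finrank_range_coboundary (h : Γ.Connected) :
    Fintype.card Γ.V ≤ Module.finrank ℝ (LinearMap.range Γ.coboundary) + 1 := by
  obtain ⟨⟨v₀⟩, hpath⟩ := h
  have hker : LinearMap.ker Γ.coboundary ≤ Submodule.span ℝ {fun _ => (1 : ℝ)} := by
    intro f hf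
    refine Submodule.mem_span_singleton.mpr ⟨f v₀, funext fun v => ?_⟩
    obtain ⟨L, hL⟩ := hpath v₀ v
    have hdiff := hL.integral_coboundary f
    rw [LinearMap.mem_ker.mp hf, map_zero] at hdiff
    simp only [Pi.smul_apply, smul_eq_mul, mul_one]
    linarith
  have hrank := Γ.coboundary.finrank_range_add_finrank_ker
  rw [Module.finrank_fintype_fun_eq_card] at hrank
  have hone := (Submodule.finrank_mono hker).trans (finrank_span_le_card _)
  rw [Set.toFinset_singleton, Finset.card_singleton] at hone
  lia

/-- The integrals along closed paths vanish on the coboundaries. -/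
theorem Connected.card_add_card_le {B : Type*} [Fintype B] (h : Γ.Connected) {v : B → Γ.V}
    {L : B → List Γ.Dart} (hL : ∀ b, Γ.IsPath (v b) (L b) (v b))
    (hindep : LinearIndependent ℝ fun b => integral (L b)) :
    Fintype.card B + Fintype.card Γ.V ≤ Fintype.card Γ.E + 1 := by
  have hann : Submodule.span ℝ (Set.range fun b => integral (L b)) ≤
      (LinearMap.range Γ.coboundary).dualAnnihilator := by
    rw [Submodule.span_le]
    rintro _ ⟨b, rfl⟩
    refine (Submodule.mem_dualAnnihilator _).mpr ?_
    rintro _ ⟨f, rfl⟩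
    rw [(hL b).integral_coboundary, sub_self]
  have hB := Submodule.finrank_mono hann
  rw [finrank_span_eq_card hindep] at hB
  have hE := Subspace.finrank_add_finrank_dualAnnihilator_eq (LinearMap.range Γ.coboundary)
  rw [Module.finrank_fintype_fun_eq_card] at hE
  have hV := h.card_le_finrank_range_coboundary
  lia

end Homology

end FinGraph

open FinGraph

theorem map_freeGroup_mk_eq_one {α H : Type*} [Group H] (f : FreeGroup α →* H)
    {L : List (α × Bool)} (hL : ∀ d ∈ L, f (FreeGroup.of d.1) = 1) : f (FreeGroup.mk L) = 1 := by
  rw [← FreeGroup.lift.apply_symm_apply f, FreeGroup.lift_mk]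
  refine List.prod_eq_one fun x hx => ?_
  obtain ⟨⟨e, b⟩, hd, rfl⟩ := List.mem_map.mp hx
  have he : FreeGroup.lift.symm f e = 1 := hL _ hd
  cases b <;> simp [he]

/-- A rooted spanning tree of a graph, described by the last oriented edge `parent v` of the tree
path from the root to each vertex `v` other than the root. -/
structure SpanningTree (Γ : FinGraph) where
  root : Γ.V
  parent : {v // v ≠ root} → Γ.Dart
  height : Γ.V → ℕ
  finish_parent : ∀ v, Γ.finish (parent v) = v
  height_lt : ∀ v, height (Γ.start (parent v)) < height v

namespace SpanningTree

variable {Γ : FinGraph} (T : SpanningTree Γ)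

/-- The edges of the tree, as opposed to the parents of the vertices, which are oriented. -/
def IsTreeEdge (e : Γ.E) : Prop := ∃ v, (T.parent v).1 = e

open Classical in
/-- The tree path from the root to `v`. -/
noncomputable def path {Γ : FinGraph} (T : SpanningTree Γ) (v : Γ.V) : List Γ.Dart :=
  if h : v = T.root then [] else path T (Γ.start (T.parent ⟨v, h⟩)) ++ [T.parent ⟨v, h⟩]
termination_by T.height v
decreasing_by exact T.height_lt ⟨v, h⟩

theorem path_root : T.path T.root = [] := by
  rw [path, dif_pos rfl]

theorem path_coe (v : {v // v ≠ T.root}) :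
    T.path v = T.path (Γ.start (T.parent v)) ++ [T.parent v] := by
  rw [path, dif_neg v.2]

@[elab_as_elim]
theorem induction_on {p : Γ.V → Prop} (v : Γ.V) (root : p T.root)
    (step : ∀ v : {v // v ≠ T.root}, p (Γ.start (T.parent v)) → p v) : p v := by
  induction hm : T.height v using Nat.strong_induction_on generalizing v with
  | _ m ih =>
    by_cases hv : v = T.root
    · exact hv ▸ root
    · exact step ⟨v, hv⟩ (ih _ (hm ▸ T.height_lt ⟨v, hv⟩) _ rfl)

theorem isPath_path (v : Γ.V) : Γ.IsPath T.root (T.path v) v := by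
  induction v using T.induction_on with
  | root =>
    rw [path_root]
    rfl
  | step v ih =>
    rw [T.path_coe v]
    exact ih.append ⟨rfl, T.finish_parent v⟩

theorem connected {Γ : FinGraph} (T : SpanningTree Γ) : Γ.Connected :=
  ⟨⟨T.root⟩, fun u v => ⟨_, (T.isPath_path u).invRev.append (T.isPath_path v)⟩⟩

theorem isTreeEdge_of_mem_path {v : Γ.V} : ∀ d ∈ T.path v, T.IsTreeEdge d.1 := by
  induction v using T.induction_on with
  | root => simp [path_root]
  | step v ih =>
    intro d hd
    rw [T.path_coe v, List.mem_append, List.mem_singleton] at hd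
    rcases hd with hd | rfl
    · exact ih d hd
    · exact ⟨v, rfl⟩

theorem not_isSeparating_of_not_isTreeEdge {e : Γ.E} (he : ¬ T.IsTreeEdge e) :
    ¬ Γ.IsSeparating e := by
  have hpath (v : Γ.V) : e ∉ (T.path v).map Prod.fst := fun h => by
    obtain ⟨d, hd, rfl⟩ := List.mem_map.mp h
    exact he (T.isTreeEdge_of_mem_path d hd)
  refine not_isSeparating_iff_exists_isPath (d := (e, true)).mpr
    ⟨_, (T.isPath_path (Γ.src e)).invRev.append (T.isPath_path (Γ.tgt e)), ?_⟩
  rw [List.map_append, map_fst_invRev, List.mem_append, List.mem_reverse, not_or]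
  exact ⟨hpath _, hpath _⟩

theorem parent_fst_injective : Function.Injective fun v => (T.parent v).1 := by
  intro v w h
  rcases eq_or_eq_rev h with heq | heq
  · exact Subtype.ext (by rw [← T.finish_parent v, ← T.finish_parent w, heq])
  · -- The edge would have to be traversed upwards in both directions.
    have hstart : Γ.start (T.parent w) = v := by rw [heq, start_rev, T.finish_parent v]
    have hstart' : Γ.start (T.parent v) = w := by rw [← T.finish_parent w, heq, finish_rev]
    have hlt := T.height_lt v
    have hlt' := T.height_lt w
    rw [hstart'] at hlt
    rw [hstart] at hlt'
    exact absurd hlt hlt'.asymm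

theorem ncard_setOf_isTreeEdge : {e | T.IsTreeEdge e}.ncard + 1 = Fintype.card Γ.V := by
  have hrange : {e | T.IsTreeEdge e} = Set.range fun v => (T.parent v).1 := rfl
  rw [hrange, ← Nat.card_coe_set_eq, Nat.card_range_of_injective T.parent_fst_injective,
    ← Nat.card_eq_fintype_card, ← Set.ncard_add_ncard_compl {T.root}, Set.ncard_singleton, add_comm]
  rfl

open Classical in
theorem card_not_isTreeEdge_add_card :
    Fintype.card {e // ¬ T.IsTreeEdge e} + Fintype.card Γ.V = Fintype.card Γ.E + 1 := by
  have hcompl := Set.ncard_add_ncard_compl {e | T.IsTreeEdge e}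
  have hcotree : {e | T.IsTreeEdge e}ᶜ.ncard = Fintype.card {e // ¬ T.IsTreeEdge e} :=
    (Nat.card_coe_set_eq _).symm.trans Nat.card_eq_fintype_card
  rw [hcotree, Nat.card_eq_fintype_card] at hcompl
  have htree := T.ncard_setOf_isTreeEdge
  lia

/-- The closed path at the root that passes the edge `e` once and runs in the tree otherwise. -/
noncomputable def fundamentalLoop (e : Γ.E) : List Γ.Dart :=
  T.path (Γ.src e) ++ [(e, true)] ++ FreeGroup.invRev (T.path (Γ.tgt e))

theorem isPath_fundamentalLoop (e : Γ.E) : Γ.IsPath T.root (T.fundamentalLoop e) T.root :=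
  ((T.isPath_path _).append (isPath_singleton (e, true))).append (T.isPath_path _).invRev

theorem mk_fundamentalLoop (e : Γ.E) : FreeGroup.mk (T.fundamentalLoop e) =
    FreeGroup.mk (T.path (Γ.src e)) * FreeGroup.of e * (FreeGroup.mk (T.path (Γ.tgt e)))⁻¹ := by
  rw [fundamentalLoop, ← FreeGroup.mul_mk, ← FreeGroup.mul_mk, FreeGroup.inv_mk]
  rfl

/-- The retraction of the free group on the edges onto the fundamental group at the root, which
collapses the tree. -/
noncomputable def retract : FreeGroup Γ.E →* FreeGroup Γ.E :=
  FreeGroup.lift fun e => FreeGroup.mk (T.fundamentalLoop e)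

theorem retract_of (e : Γ.E) :
    T.retract (FreeGroup.of e) = FreeGroup.mk (T.fundamentalLoop e) :=
  FreeGroup.lift_apply_of

theorem retract_mk_singleton (d : Γ.Dart) : T.retract (FreeGroup.mk [d]) =
    FreeGroup.mk (T.path (Γ.start d)) * FreeGroup.mk [d] *
      (FreeGroup.mk (T.path (Γ.finish d)))⁻¹ := by
  obtain ⟨e, _ | _⟩ := d
  · change T.retract (FreeGroup.of e)⁻¹ = FreeGroup.mk (T.path (Γ.tgt e)) * (FreeGroup.of e)⁻¹ *
      (FreeGroup.mk (T.path (Γ.src e)))⁻¹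
    rw [map_inv, retract_of, mk_fundamentalLoop]
    group
  · exact (T.retract_of e).trans (T.mk_fundamentalLoop e)

theorem retract_mk_of_isPath {u v : Γ.V} {L : List Γ.Dart} (h : Γ.IsPath u L v) :
    T.retract (FreeGroup.mk L) =
      FreeGroup.mk (T.path u) * FreeGroup.mk L * (FreeGroup.mk (T.path v))⁻¹ := by
  induction L generalizing u with
  | nil =>
    obtain rfl : u = v := h
    rw [← FreeGroup.one_eq_mk, mul_one, mul_inv_cancel, map_one]
  | cons d L ih =>
    rw [← List.singleton_append, ← FreeGroup.mul_mk, map_mul, ih h.2, retract_mk_singleton, h.1]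
    group

theorem retract_eq_self {x : FreeGroup Γ.E} (hx : x ∈ Γ.pi1 T.root) : T.retract x = x := by
  obtain ⟨L, hL, rfl⟩ := hx
  rw [T.retract_mk_of_isPath hL, path_root, ← FreeGroup.one_eq_mk, one_mul, inv_one, mul_one]

theorem mk_fundamentalLoop_of_isTreeEdge {e : Γ.E} (he : T.IsTreeEdge e) :
    FreeGroup.mk (T.fundamentalLoop e) = 1 := by
  obtain ⟨v, rfl⟩ := he
  have hparent : T.retract (FreeGroup.mk [T.parent v]) = 1 := by
    rw [retract_mk_singleton, T.finish_parent v, T.path_coe v, ← FreeGroup.mul_mk,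
      mul_inv_cancel]
  rw [← retract_of]
  rcases hd : T.parent v with ⟨e, _ | _⟩
  · rw [hd] at hparent
    exact inv_eq_one.mp ((map_inv T.retract (FreeGroup.of e)).symm.trans hparent)
  · rwa [hd] at hparent

theorem conj_mk_eq_mk_fundamentalLoop {v : Γ.V} {A : List Γ.Dart} {e : Γ.E}
    (h : Γ.IsPath v (A ++ [(e, true)]) v) (hA : ∀ d ∈ A, T.IsTreeEdge d.1) :
    FreeGroup.mk (T.path v) * FreeGroup.mk (A ++ [(e, true)]) * (FreeGroup.mk (T.path v))⁻¹ =
      FreeGroup.mk (T.fundamentalLoop e) := by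
  have hretract : T.retract (FreeGroup.mk A) = 1 := map_freeGroup_mk_eq_one _ fun d hd => by
    rw [retract_of, T.mk_fundamentalLoop_of_isTreeEdge (hA d hd)]
  rw [← T.retract_mk_of_isPath h, ← FreeGroup.mul_mk, map_mul, hretract, one_mul, ← retract_of]
  rfl

/-- The homomorphism from the free group on the edges outside the tree to the free group on all
edges that sends each of these edges to its fundamental loop. -/
noncomputable def fundamentalHom : FreeGroup {e // ¬ T.IsTreeEdge e} →* FreeGroup Γ.E :=
  FreeGroup.lift fun e => FreeGroup.mk (T.fundamentalLoop e.1)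

open Classical in
/-- The homomorphism of free groups on edges that collapses the tree to a point. -/
noncomputable def collapse : FreeGroup Γ.E →* FreeGroup {e // ¬ T.IsTreeEdge e} :=
  FreeGroup.lift fun e => if h : T.IsTreeEdge e then 1 else FreeGroup.of ⟨e, h⟩

theorem collapse_of_isTreeEdge {e : Γ.E} (he : T.IsTreeEdge e) :
    T.collapse (FreeGroup.of e) = 1 := by
  rw [collapse, FreeGroup.lift_apply_of, dif_pos he]

theorem collapse_mk_fundamentalLoop (e : {e // ¬ T.IsTreeEdge e}) :
    T.collapse (FreeGroup.mk (T.fundamentalLoop e.1)) = FreeGroup.of e := by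
  have hpath (v : Γ.V) : T.collapse (FreeGroup.mk (T.path v)) = 1 :=
    map_freeGroup_mk_eq_one _ fun d hd => T.collapse_of_isTreeEdge (T.isTreeEdge_of_mem_path d hd)
  rw [mk_fundamentalLoop, map_mul, map_mul, map_inv, hpath, hpath, one_mul, inv_one, mul_one,
    collapse, FreeGroup.lift_apply_of, dif_neg e.2]

theorem fundamentalHom_injective : Function.Injective T.fundamentalHom := by
  have hcomp : T.collapse.comp T.fundamentalHom = MonoidHom.id _ := by
    ext e
    simp [fundamentalHom, collapse_mk_fundamentalLoop]
  exact Function.LeftInverse.injective fun x => DFunLike.congr_fun hcomp x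

theorem range_fundamentalHom : T.fundamentalHom.range = Γ.pi1 T.root := by
  apply le_antisymm
  · refine FreeGroup.range_lift_le ?_
    rintro _ ⟨e, rfl⟩
    exact ⟨_, T.isPath_fundamentalLoop e.1, rfl⟩
  · have hretract : T.retract.range ≤ T.fundamentalHom.range := by
      refine FreeGroup.range_lift_le ?_
      rintro _ ⟨e, rfl⟩
      by_cases he : T.IsTreeEdge e
      · change FreeGroup.mk (T.fundamentalLoop e) ∈ T.fundamentalHom.range
        rw [T.mk_fundamentalLoop_of_isTreeEdge he]
        exact one_mem _
      · exact ⟨FreeGroup.of ⟨e, he⟩, FreeGroup.lift_apply_of⟩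
    intro x hx
    exact T.retract_eq_self hx ▸ hretract ⟨x, rfl⟩

end SpanningTree

theorem ncard_edgeSet_lt_of_isAcyclic {V : Type*} [Fintype V] [Nonempty V] {F : SimpleGraph V}
    (hF : F.IsAcyclic) : F.edgeSet.ncard < Fintype.card V := by
  classical
  obtain ⟨T, hle, -, hT⟩ :=
    SimpleGraph.connected_top.exists_isTree_le_of_le_of_isAcyclic le_top hF
  calc F.edgeSet.ncard ≤ T.edgeSet.ncard := Set.ncard_le_ncard (SimpleGraph.edgeSet_mono hle)
    _ < T.edgeFinset.card + 1 := by
        rw [← SimpleGraph.coe_edgeFinset T, Set.ncard_coe_finset]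
        exact Nat.lt_succ_self _
    _ = Fintype.card V := hT.card_edgeFinset

/-- The index set of the wedge cycles: `⟨j, i⟩` stands for the circle `C_i^j`. -/
abbrev Petal {k : ℕ} (s : Fin k → ℕ) : Type := Σ j : Fin k, Fin (s j)

namespace RelGraph

variable {n k : ℕ} {s : Fin k → ℕ} (G : RelGraph n s)

theorem petal_unique {e : G.E} {p p' : Petal s} (h : e ∈ (G.petal p.1 p.2).map Prod.fst)
    (h' : e ∈ (G.petal p'.1 p'.2).map Prod.fst) : p = p' := by
  obtain ⟨j, i⟩ := p
  obtain ⟨j', i'⟩ := p'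
  obtain rfl : j = j' := by_contra fun hj => G.wedge_edges_disjoint j j' hj i i' h h'
  obtain rfl : i = i' := by_contra fun hi => G.petal_edges_disjoint j i i' hi h h'
  rfl

open Classical in
/-- The petal which contains a given edge, if there is one. -/
noncomputable def petalOf (e : G.E) : Option (Petal s) :=
  if h : ∃ p : Petal s, e ∈ (G.petal p.1 p.2).map Prod.fst then some h.choose else none

theorem petalOf_eq_some_iff {e : G.E} {p : Petal s} :
    G.petalOf e = some p ↔ e ∈ (G.petal p.1 p.2).map Prod.fst := by
  unfold petalOf
  split_ifs with h
  · rw [Option.some_inj]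
    exact ⟨fun hp => hp ▸ h.choose_spec, fun hp => G.petal_unique h.choose_spec hp⟩
  · simpa using fun hp => h ⟨p, hp⟩

theorem petalOf_eq_none_iff {e : G.E} :
    G.petalOf e = none ↔ ∀ j i, e ∉ (G.petal j i).map Prod.fst := by
  simp only [Option.eq_none_iff_forall_ne_some, ne_eq, petalOf_eq_some_iff, Sigma.forall]

theorem exists_petalOf_eq_some (p : Petal s) : ∃ e, G.petalOf e = some p := by
  obtain ⟨d, hd⟩ := List.exists_mem_of_ne_nil _ (G.petal_ne_nil p.1 p.2)
  exact ⟨d.1, G.petalOf_eq_some_iff.mpr (List.mem_map_of_mem hd)⟩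

open Classical in
theorem toFinset_map_fst_petal (p : Petal s) :
    ((G.petal p.1 p.2).map Prod.fst).toFinset =
      Finset.univ.filter fun e => G.petalOf e = some p := by
  ext e
  rw [List.mem_toFinset, Finset.mem_filter_univ, petalOf_eq_some_iff]

open Classical in
theorem sum_map_petal (l : G.E → ℝ) (p : Petal s) :
    ((G.petal p.1 p.2).map fun d => l d.1).sum = ∑ e with G.petalOf e = some p, l e := by
  rw [← toFinset_map_fst_petal, List.sum_toFinset l (G.petal_edges_nodup p.1 p.2), List.map_map]
  rfl

/-- The two half edges of a petal at its basepoint. -/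
def petalEnd (p : Petal s) (b : Bool) : G.Dart :=
  if b then (G.petal p.1 p.2).head (G.petal_ne_nil _ _)
  else rev ((G.petal p.1 p.2).getLast (G.petal_ne_nil _ _))

theorem petalEnd_fst_mem (p : Petal s) (b : Bool) :
    (G.petalEnd p b).1 ∈ (G.petal p.1 p.2).map Prod.fst := by
  cases b
  · exact List.mem_map.mpr ⟨_, List.getLast_mem (G.petal_ne_nil _ _), rfl⟩
  · exact List.mem_map.mpr ⟨_, List.head_mem (G.petal_ne_nil _ _), rfl⟩

theorem start_petalEnd (p : Petal s) (b : Bool) : G.start (G.petalEnd p b) = G.base p.1 := by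
  cases b
  · exact (start_rev _).trans ((G.petal_isPath _ _).finish_getLast _)
  · exact (G.petal_isPath _ _).start_head _

theorem petalEnd_true_ne_petalEnd_false (p : Petal s) :
    G.petalEnd p true ≠ G.petalEnd p false := by
  intro h
  have hfst : (G.petalEnd p true).1 = (G.petalEnd p false).1 := congrArg Prod.fst h
  have hhead := List.inj_on_of_nodup_map (G.petal_edges_nodup p.1 p.2)
    (List.head_mem (G.petal_ne_nil _ _)) (List.getLast_mem (G.petal_ne_nil _ _)) hfst
  exact rev_ne _ (h.symm.trans hhead)

theorem petalEnd_injective : Function.Injective fun q : Petal s × Bool => G.petalEnd q.1 q.2 := by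
  rintro ⟨p, b⟩ ⟨p', b'⟩ h
  replace h : G.petalEnd p b = G.petalEnd p' b' := h
  obtain rfl : p = p' := G.petal_unique (h ▸ G.petalEnd_fst_mem p b) (G.petalEnd_fst_mem p' b')
  cases b <;> cases b'
  · rfl
  · exact absurd h.symm (G.petalEnd_true_ne_petalEnd_false p)
  · exact absurd h (G.petalEnd_true_ne_petalEnd_false p)
  · rfl

theorem sum_le_valence [DecidableEq G.V] (v : G.V) :
    ∑ j with G.base j = v, 2 * s j ≤ G.valence v := by
  let ends : Finset (Petal s × Bool) := {q | G.base q.1.1 = v}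
  calc ∑ j with G.base j = v, 2 * s j = ends.card := by
        rw [Finset.card_filter, Fintype.sum_prod_type, Fintype.sum_sigma, Finset.sum_filter]
        refine Finset.sum_congr rfl fun j _ => ?_
        split_ifs <;> simp_all [mul_comm]
    _ = (ends.map ⟨_, G.petalEnd_injective⟩).card := (Finset.card_map _).symm
    _ ≤ G.valence v := by
        refine card_le_valence fun d hd => ?_
        obtain ⟨q, hq, rfl⟩ := Finset.mem_map.mp hd
        exact (G.start_petalEnd q.1 q.2).trans (Finset.mem_filter_univ q |>.mp hq)

theorem three_add_sum_le_valence [DecidableEq G.V] (v : G.V) :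
    3 + ∑ j with G.base j = v, (2 * s j - 3) ≤ G.valence v := by
  by_cases h : ∃ j, G.base j = v ∧ 2 ≤ s j
  · obtain ⟨j, hj, hsj⟩ := h
    have hmem : j ∈ Finset.univ.filter fun j => G.base j = v := by simpa using hj
    refine le_trans ?_ (G.sum_le_valence v)
    rw [← Finset.add_sum_erase _ _ hmem, ← Finset.add_sum_erase _ _ hmem, ← add_assoc]
    exact add_le_add (by lia) (Finset.sum_le_sum fun i _ => Nat.sub_le _ _)
  · rw [Finset.sum_eq_zero fun j hj => ?_]
    · exact G.three_le_valence v
    · have hsj : ¬ 2 ≤ s j := fun hsj => h ⟨j, by simpa using hj, hsj⟩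
      lia

theorem card_edges_le (hs : ∀ j, 1 ≤ s j) :
    Fintype.card G.E + 2 * ∑ j, s j + (Finset.univ.filter fun j => s j = 1).card + 3 ≤
      3 * n + 3 * k := by
  let _ : DecidableEq G.V := Classical.decEq _
  have hvalence : 3 * Fintype.card G.V + ∑ j, (2 * s j - 3) ≤ 2 * Fintype.card G.E := by
    calc 3 * Fintype.card G.V + ∑ j, (2 * s j - 3)
        = ∑ v, (3 + ∑ j with G.base j = v, (2 * s j - 3)) := by
          rw [Finset.sum_add_distrib, Finset.sum_fiberwise, Finset.sum_const, Finset.card_univ,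
            smul_eq_mul, mul_comm]
      _ ≤ ∑ v, G.valence v := Finset.sum_le_sum fun v _ => G.three_add_sum_le_valence v
      _ = 2 * Fintype.card G.E := sum_valence
  have hsum : ∑ j, (2 * s j - 3) + 3 * k =
      2 * ∑ j, s j + (Finset.univ.filter fun j => s j = 1).card := by
    have hk : 3 * k = ∑ _j : Fin k, 3 := by simp [mul_comm]
    rw [hk, Finset.card_filter, Finset.mul_sum, ← Finset.sum_add_distrib,
      ← Finset.sum_add_distrib]
    refine Finset.sum_congr rfl fun j _ => ?_
    have := hs j
    split_ifs <;> lia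
  have hrank := G.rank_eq
  lia

/-- The vertex `v` lies on the `j`-th wedge. -/
def OnWedge (j : Fin k) (v : G.V) : Prop := ∃ i, v ∈ (G.petal j i).map G.start

theorem onWedge_base {j : Fin k} (hj : 1 ≤ s j) : G.OnWedge j (G.base j) :=
  ⟨⟨0, hj⟩, (G.petal_isPath j _).base_mem (G.petal_ne_nil j _)⟩

/-- The points in which at least two wedges meet. -/
def meeting : Set G.V := {v | ∃ j j', j ≠ j' ∧ G.OnWedge j v ∧ G.OnWedge j' v}

/-- The number of wedges through a vertex. -/
noncomputable def wedgeCount (v : G.V) : ℕ := {j | G.OnWedge j v}.ncard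

theorem two_le_wedgeCount {v : G.V} (hv : v ∈ G.meeting) : 2 ≤ G.wedgeCount v := by
  obtain ⟨j, j', hne, hj, hj'⟩ := hv
  exact (Set.one_lt_ncard_iff (Set.toFinite _)).mpr ⟨j, j', hj, hj', hne⟩

theorem wedgeCount_le_one {v : G.V} (hv : v ∉ G.meeting) : G.wedgeCount v ≤ 1 :=
  (Set.ncard_le_one (Set.toFinite _)).mpr fun j hj j' hj' =>
    by_contra fun hne => hv ⟨j, j', hne, hj, hj'⟩

open Classical in
/-- The left-hand side counts the edges of the dual graph. -/
theorem sum_wedgeCount_meeting_lt [Nonempty (Fin k)] :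
    ∑ v with v ∈ G.meeting, G.wedgeCount v <
      k + (Finset.univ.filter fun v => v ∈ G.meeting).card := by
  let Incidence := Σ v : G.meeting, {j : Fin k // G.OnWedge j v}
  let toEdge : Incidence → Sym2 (Fin k ⊕ G.meeting) := fun q => s(Sum.inl q.2.1, Sum.inr q.1)
  have hinj : Function.Injective toEdge := by
    rintro ⟨v, j⟩ ⟨v', j'⟩ h
    simp only [toEdge, Sym2.eq_iff, Sum.inl.injEq, Sum.inr.injEq, reduceCtorEq, and_self,
      or_false] at h
    obtain ⟨hj, rfl⟩ := h
    rw [Subtype.ext hj]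
  calc ∑ v with v ∈ G.meeting, G.wedgeCount v = Nat.card Incidence := by
        rw [Nat.card_sigma, Finset.sum_subtype (p := fun v => v ∈ G.meeting) _ (by simp)]
        rfl
    _ = (Set.range toEdge).ncard := by
        rw [← Nat.card_range_of_injective hinj, Nat.card_coe_set_eq]
    _ ≤ _ := by
        refine Set.ncard_le_ncard ?_ (Set.toFinite _)
        rintro _ ⟨⟨v, j, hj⟩, rfl⟩
        exact ⟨Sum.inl_ne_inr, Or.inl ⟨j, v, rfl, rfl, hj⟩⟩
    _ < Fintype.card (Fin k ⊕ G.meeting) := ncard_edgeSet_lt_of_isAcyclic G.dual_isAcyclic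
    _ = _ := by rw [Fintype.card_sum, Fintype.card_fin, Fintype.card_subtype]

open Classical in
theorem card_meeting_lt [Nonempty (Fin k)] :
    (Finset.univ.filter fun v => v ∈ G.meeting).card < k := by
  have hlt := G.sum_wedgeCount_meeting_lt
  have htwo := Finset.card_nsmul_le_sum (Finset.univ.filter fun v => v ∈ G.meeting) G.wedgeCount 2
    fun v hv => G.two_le_wedgeCount (by simpa using hv)
  rw [smul_eq_mul] at htwo
  lia

theorem sum_wedgeCount_lt : ∑ v, G.wedgeCount v < k + Fintype.card G.V := by
  classical
  rcases isEmpty_or_nonempty (Fin k) with hk | hk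
  · have : Nonempty G.V := G.connected.1
    have hzero : ∀ v, G.wedgeCount v = 0 := fun v =>
      (Set.ncard_eq_zero (Set.toFinite _)).mpr (Subsingleton.elim _ _)
    simp only [hzero, Finset.sum_const_zero]
    exact Nat.add_pos_right _ Fintype.card_pos
  · have hmeeting := G.sum_wedgeCount_meeting_lt
    have hrest := Finset.sum_le_card_nsmul (Finset.univ.filter fun v => v ∉ G.meeting)
      G.wedgeCount 1 fun v hv => G.wedgeCount_le_one (by simpa using hv)
    rw [← Finset.sum_filter_add_sum_filter_not Finset.univ (fun v => v ∈ G.meeting) G.wedgeCount,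
      ← Finset.card_univ,
      ← Finset.card_filter_add_card_filter_not (s := Finset.univ) (fun v => v ∈ G.meeting)]
    lia

theorem sum_length_petal_lt {j : Fin k} (hj : 1 ≤ s j) :
    ∑ i, (G.petal j i).length < s j + {v | G.OnWedge j v}.ncard := by
  classical
  let punctured (i : Fin (s j)) : Finset G.V :=
    ((G.petal j i).map G.start).toFinset.erase (G.base j)
  have hcard (i) : (punctured i).card + 1 = (G.petal j i).length := by
    rw [Finset.card_erase_add_one, List.toFinset_card_of_nodup (G.petal_vertices_nodup j i),
      List.length_map]
    exact List.mem_toFinset.mpr ((G.petal_isPath j i).base_mem (G.petal_ne_nil j i))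
  have hdisj : (Set.univ : Set (Fin (s j))).PairwiseDisjoint punctured := by
    intro i _ i' _ hne
    refine Finset.disjoint_left.mpr fun v hv hv' => ?_
    simp only [punctured, Finset.mem_erase, List.mem_toFinset] at hv hv'
    exact hv.1 (G.petal_vertices_inter j i i' hne v hv.2 hv'.2)
  have hunion : ((insert (G.base j) (Finset.univ.biUnion punctured) : Finset G.V) : Set G.V) ⊆
      {v | G.OnWedge j v} := by
    intro v hv
    rcases Finset.mem_insert.mp hv with rfl | hv
    · exact G.onWedge_base hj
    · obtain ⟨i, -, hi⟩ := Finset.mem_biUnion.mp hv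
      exact ⟨i, List.mem_toFinset.mp (Finset.mem_of_mem_erase hi)⟩
  calc ∑ i, (G.petal j i).length = s j + ∑ i, (punctured i).card := by
        simp only [← hcard, Finset.sum_add_distrib]
        simp [add_comm]
    _ < s j + (insert (G.base j) (Finset.univ.biUnion punctured)).card := by
        rw [Finset.card_insert_of_notMem (by simp [punctured]),
          Finset.card_biUnion (by simpa [Set.PairwiseDisjoint, Set.Pairwise] using hdisj)]
        lia
    _ ≤ s j + {v | G.OnWedge j v}.ncard := by
        rw [← Set.ncard_coe_finset]
        exact Nat.add_le_add_left (Set.ncard_le_ncard hunion (Set.toFinite _)) _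

theorem card_edges_eq_sum_length (h : ∀ e, G.petalOf e ≠ none) :
    Fintype.card G.E = ∑ j, ∑ i, (G.petal j i).length := by
  classical
  have hnone : (Finset.univ.filter fun e => G.petalOf e = none) = ∅ :=
    Finset.filter_eq_empty_iff.mpr fun e _ => h e
  rw [← Finset.card_univ, Finset.card_eq_sum_card_fiberwise (f := G.petalOf) (t := Finset.univ)
    (by simp), Fintype.sum_option, hnone, Finset.card_empty, zero_add, Fintype.sum_sigma]
  simp only [← toFinset_map_fst_petal,
    List.toFinset_card_of_nodup (G.petal_edges_nodup _ _), List.length_map]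

theorem rank_le_of_petalOf_ne_none (hs : ∀ j, 1 ≤ s j) (h : ∀ e, G.petalOf e ≠ none) :
    n ≤ ∑ j, s j := by
  classical
  have hdouble : ∑ j, {v | G.OnWedge j v}.ncard = ∑ v, G.wedgeCount v := by
    simp only [wedgeCount, Set.ncard_eq_toFinset_card', Set.toFinset_ofPred, Finset.card_filter]
    exact Finset.sum_comm
  have hlength := Finset.sum_le_sum fun j (_ : j ∈ Finset.univ) =>
    Nat.succ_le_of_lt (G.sum_length_petal_lt (hs j))
  simp only [Nat.succ_eq_add_one, Finset.sum_add_distrib, Finset.sum_const, Finset.card_univ,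
    Fintype.card_fin, smul_eq_mul, mul_one, hdouble, ← G.card_edges_eq_sum_length h] at hlength
  have hcount := G.sum_wedgeCount_lt
  have hrank := G.rank_eq
  lia

theorem exists_base_eq (h : ∀ e, G.petalOf e ≠ none) {v : G.V} (hv : v ∉ G.meeting) :
    ∃ j, 2 ≤ s j ∧ G.base j = v := by
  classical
  have hpetal (d : G.Dart) : ∃ p : Petal s, d.1 ∈ (G.petal p.1 p.2).map Prod.fst := by
    obtain ⟨p, hp⟩ := Option.ne_none_iff_exists'.mp (h d.1)
    exact ⟨p, G.petalOf_eq_some_iff.mp hp⟩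
  have hvalence := G.three_le_valence v
  obtain ⟨d₀, hd₀⟩ : ∃ d : G.Dart, G.start d = v := by
    rw [valence_eq_card_filter_start] at hvalence
    obtain ⟨d, hd⟩ := Finset.card_pos.mp (pos_of_gt hvalence)
    exact ⟨d, by simpa using hd⟩
  obtain ⟨⟨j, i⟩, hi⟩ := hpetal d₀
  have hmem := hd₀ ▸ (G.petal_isPath j i).start_mem_of_fst_mem hi
  by_contra! hbase
  refine absurd ((G.petal_isPath j i).valence_le_two (G.petal_vertices_nodup j i) (v := v) ?_)
    (by lia)
  intro d hd
  obtain ⟨⟨j', i'⟩, hi'⟩ := hpetal d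
  have hmem' := hd ▸ (G.petal_isPath j' i').start_mem_of_fst_mem hi'
  obtain rfl : j = j' := by_contra fun hne => hv ⟨j, j', hne, ⟨i, hmem⟩, ⟨i', hmem'⟩⟩
  by_cases hii : i = i'
  · exact hii ▸ hi'
  · have hsj : 2 ≤ s j := by lia
    exact absurd (G.petal_vertices_inter j i i' hii v hmem hmem').symm (hbase j hsj)

theorem card_vertices_lt [Nonempty (Fin k)] (h : ∀ e, G.petalOf e ≠ none) :
    Fintype.card G.V < (Finset.univ.filter fun j => 2 ≤ s j).card + k := by
  classical
  have hcover : Finset.univ ⊆ (Finset.univ.filter fun j => 2 ≤ s j).image G.base ∪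
      Finset.univ.filter fun v => v ∈ G.meeting := by
    intro v _
    by_cases hv : v ∈ G.meeting
    · exact Finset.mem_union_right _ (by simpa using hv)
    · obtain ⟨j, hj, rfl⟩ := G.exists_base_eq h hv
      exact Finset.mem_union_left _ (Finset.mem_image_of_mem _ (by simpa using hj))
  calc Fintype.card G.V ≤ _ := (Finset.card_le_card hcover).trans (Finset.card_union_le _ _)
    _ < _ := add_lt_add_of_le_of_lt Finset.card_image_le G.card_meeting_lt

theorem linearIndependent_integral_petal :
    LinearIndependent ℝ fun p : Petal s => integral (G.petal p.1 p.2) := by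
  classical
  choose e he using G.exists_petalOf_eq_some
  simp only [petalOf_eq_some_iff] at he
  refine Fintype.linearIndependent_iff.mpr fun c hc p => ?_
  have heval := LinearMap.congr_fun hc (Pi.single (e p) 1)
  rw [LinearMap.sum_apply, Finset.sum_eq_single p] at heval
  · exact (mul_eq_zero.mp heval).resolve_right
      (integral_single_ne_zero (G.petal_edges_nodup _ _) (he p))
  · intro q _ hq
    rw [LinearMap.smul_apply,
      integral_single_of_notMem fun h => hq (G.petal_unique h (he p)), smul_zero]
  · simp

theorem sum_lt_rank_of_not_isSeparating {e : G.E} (he : G.petalOf e = none)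
    (hsep : ¬ G.IsSeparating e) : ∑ j, s j < n := by
  classical
  obtain ⟨L, hL, hne⟩ := not_not.mp hsep
  have heL : e ∉ L.map Prod.fst := by
    rintro hmem
    obtain ⟨d, hd, rfl⟩ := List.mem_map.mp hmem
    exact hne d hd rfl
  let cycle : Option (Petal s) → List G.Dart := fun o =>
    o.elim (L ++ [(e, false)]) fun p => G.petal p.1 p.2
  have hcycle : ∀ o, ∃ v, G.IsPath v (cycle o) v
    | none => ⟨_, hL.append (isPath_singleton (e, false))⟩
    | some p => ⟨_, G.petal_isPath p.1 p.2⟩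
  choose v hv using hcycle
  have hindep : LinearIndependent ℝ fun o => integral (cycle o) := by
    refine linearIndependent_option.mpr ⟨G.linearIndependent_integral_petal, fun hspan => ?_⟩
    -- The functional `l ↦ l e` separates the new cycle from the petals, which avoid `e`.
    have hker : Submodule.span ℝ (Set.range ((fun o => integral (cycle o)) ∘ some)) ≤
        LinearMap.ker (Module.Dual.eval ℝ (G.E → ℝ) (Pi.single e 1)) := by
      rw [Submodule.span_le]
      rintro _ ⟨p, rfl⟩
      exact integral_single_of_notMem (G.petalOf_eq_none_iff.mp he p.1 p.2)
    have hzero : integral (L ++ [(e, false)]) (Pi.single e 1) = 0 := hker hspan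
    rw [integral_append, LinearMap.add_apply, integral_single_of_notMem heL, zero_add] at hzero
    exact integral_single_ne_zero (L := [(e, false)]) (List.nodup_singleton e)
      (List.mem_singleton_self e) hzero
  have hcard := G.connected.card_add_card_le hv hindep
  rw [Fintype.card_option, Fintype.card_sigma] at hcard
  simp only [Fintype.card_fin] at hcard
  have hrank := G.rank_eq
  lia

end RelGraph

namespace MarkedGraph

variable {n k : ℕ} {s : Fin k → ℕ} (G : MarkedGraph n s)

theorem mem_outside_iff {e : G.E} : e ∈ G.outside ↔ G.petalOf e = none :=
  G.petalOf_eq_none_iff.symm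

open Classical in
/-- The value `none` of `petalOf` accounts for the constraint on the relative volume. -/
theorem polysimplex_eq : G.polysimplex =
    {l | (∀ e, 0 < l e) ∧ fiberSum (Set.rangeFactorization G.petalOf) l = 1} := by
  ext l
  simp only [polysimplex, Set.mem_ofPred_eq, funext_iff, fiberSum_apply, Subtype.ext_iff,
    Set.rangeFactorization_coe, Pi.one_apply, mem_outside_iff, Set.Nonempty]
  refine and_congr_right fun _ => ⟨?_, fun h => ⟨fun j i => ?_, ?_⟩⟩
  · rintro ⟨hpetal, hvolume⟩ ⟨_ | p, e, he⟩
    · exact hvolume ⟨e, he⟩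
    · exact (G.sum_map_petal l p).symm.trans (hpetal _ _)
  · exact (G.sum_map_petal l ⟨j, i⟩).trans (h ⟨_, G.exists_petalOf_eq_some ⟨j, i⟩⟩)
  · rintro ⟨e, he⟩
    exact h ⟨none, e, he⟩

theorem polysimplex_nonempty : G.polysimplex.Nonempty := by
  classical
  rw [polysimplex_eq]
  exact exists_pos_fiberSum_eq Set.rangeFactorization_surjective fun _ => one_pos

theorem polysimplexDim_add_ncard_range :
    G.polysimplexDim + (Set.range G.petalOf).ncard = Fintype.card G.E := by
  classical
  rw [polysimplexDim, polysimplex_eq, ← Nat.card_coe_set_eq, Nat.card_eq_fintype_card]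
  exact finrank_vectorSpan_fiberSum_eq_add_card Set.rangeFactorization_surjective
    fun _ => one_pos

theorem polysimplexDim_of_outside_nonempty (h : G.outside.Nonempty) :
    G.polysimplexDim + (∑ j, s j + 1) = Fintype.card G.E := by
  obtain ⟨e, he⟩ := h
  have hrange : Set.range G.petalOf = Set.univ :=
    Set.range_eq_univ.mpr fun
      | none => ⟨e, G.mem_outside_iff.mp he⟩
      | some p => G.exists_petalOf_eq_some p
  rw [← polysimplexDim_add_ncard_range, hrange, Set.ncard_univ]
  simp

theorem polysimplexDim_of_outside_eq_empty (h : G.outside = ∅) :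
    G.polysimplexDim + ∑ j, s j = Fintype.card G.E := by
  have hrange : Set.range G.petalOf = Set.range some := by
    apply subset_antisymm
    · rintro _ ⟨e, rfl⟩
      have he : e ∉ G.outside := h ▸ Set.notMem_empty e
      rw [mem_outside_iff] at he
      exact (Option.ne_none_iff_exists.mp he)
    · rintro _ ⟨p, rfl⟩
      exact G.exists_petalOf_eq_some p
  rw [← polysimplexDim_add_ncard_range, hrange, ← Nat.card_coe_set_eq,
    Nat.card_range_of_injective (Option.some_injective _)]
  simp

theorem outside_nonempty (hs : ∀ j, 1 ≤ s j) (h : ∑ j, s j < n) : G.outside.Nonempty := by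
  by_contra! hempty
  refine (G.rank_le_of_petalOf_ne_none hs fun e he => ?_).not_gt h
  exact Set.notMem_empty e (hempty ▸ G.mem_outside_iff.mpr he)

theorem polysimplexDim_le (hs : ∀ j, 1 ≤ s j) (h : ∑ j, s j < n) :
    G.polysimplexDim + 3 * ∑ j, s j + (Finset.univ.filter fun j => s j = 1).card + 4 ≤
      3 * n + 3 * k := by
  have hdim := G.polysimplexDim_of_outside_nonempty (G.outside_nonempty hs h)
  have hcard := G.card_edges_le hs
  lia

theorem outside_eq_empty_of_forall_not_isSeparating (h : n = ∑ j, s j)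
    (hG : ∀ e, ¬ G.IsSeparating e) : G.outside = ∅ :=
  Set.eq_empty_iff_forall_notMem.mpr fun e he =>
    (G.sum_lt_rank_of_not_isSeparating (G.mem_outside_iff.mp he) (hG e)).ne' h

theorem polysimplexDim_le_of_forall_not_isSeparating [Nonempty (Fin k)] (hs : ∀ j, 1 ≤ s j)
    (h : n = ∑ j, s j) (hG : ∀ e, ¬ G.IsSeparating e) :
    G.polysimplexDim + (Finset.univ.filter fun j => s j = 1).card + 2 ≤ 2 * k := by
  have hempty := G.outside_eq_empty_of_forall_not_isSeparating h hG
  have hdim := G.polysimplexDim_of_outside_eq_empty hempty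
  have hV := G.card_vertices_lt fun e he =>
    Set.notMem_empty e (hempty ▸ G.mem_outside_iff.mpr he)
  have hfilter : (Finset.univ.filter fun j => 2 ≤ s j) =
      Finset.univ.filter fun j => ¬ s j = 1 :=
    Finset.filter_congr fun j _ => by have := hs j; lia
  have hsplit := Finset.card_filter_add_card_filter_not (s := Finset.univ) (fun j => s j = 1)
  rw [← hfilter, Finset.card_univ, Fintype.card_fin] at hsplit
  have hrank := G.rank_eq
  lia

end MarkedGraph

namespace MarkedMetricGraph

variable {n k : ℕ} {s : Fin k → ℕ} {G H : MarkedMetricGraph n s}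

theorem Equivalent.noSeparatingEdges_iff (h : G.Equivalent H) :
    (∀ e, ¬ G.IsSeparating e) ↔ ∀ e, ¬ H.IsSeparating e := by
  obtain ⟨hV, hE, flip, hends, -⟩ := h
  let φ : G.Dart ≃ H.Dart :=
    Equiv.prodShear hE fun e => if flip e then Equiv.boolNot else Equiv.refl Bool
  have hφ_true (e : G.E) : φ (e, true) = (hE e, !flip e) := by
    cases h : flip e <;> simp [φ, h]
  have hφ_rev (d : G.Dart) : φ (rev d) = rev (φ d) := by
    cases h : flip d.1 <;> simp [φ, rev, h]
  have hφ_start (d : G.Dart) : H.start (φ d) = hV (G.start d) := by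
    obtain ⟨e, _ | _⟩ := d
    · change H.start (φ (rev (e, true))) = _
      rw [hφ_rev, start_rev, hφ_true]
      exact (hends e).2
    · rw [hφ_true]
      exact (hends e).1
  refine ⟨forall_not_isSeparating_of_equiv hφ_start hφ_rev,
    forall_not_isSeparating_of_equiv (fV := hV.symm) (φ := φ.symm) (fun d => ?_) fun d => ?_⟩
  · rw [Equiv.eq_symm_apply, ← hφ_start, φ.apply_symm_apply]
  · rw [Equiv.symm_apply_eq, hφ_rev, φ.apply_symm_apply]

end MarkedMetricGraph

namespace RelOuterSpace

variable {n k : ℕ} {s : Fin k → ℕ}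

theorem mk_mem_reduced_iff (G : MarkedMetricGraph n s) :
    (Quot.mk _ G : RelOuterSpace n s) ∈ reduced n s ↔ ∀ e, ¬ G.IsSeparating e := by
  refine ⟨?_, fun h => ⟨G, h, rfl⟩⟩
  rintro ⟨H, hH, heq⟩
  let noSeparatingEdges : RelOuterSpace n s → Prop := Quot.lift
    (fun G : MarkedMetricGraph n s => ∀ e, ¬ G.IsSeparating e)
    fun _ _ h => propext h.noSeparatingEdges_iff
  have hGH : noSeparatingEdges (Quot.mk _ G) = noSeparatingEdges (Quot.mk _ H) :=
    congrArg noSeparatingEdges heq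
  exact hGH.mpr hH

theorem openPolysimplex_subset_reduced_iff (G : MarkedGraph n s) :
    openPolysimplex G ⊆ reduced n s ↔ ∀ e, ¬ G.IsSeparating e := by
  constructor
  · intro h
    obtain ⟨l, hl⟩ := G.polysimplex_nonempty
    exact (mk_mem_reduced_iff ⟨G, l, hl⟩).mp (h ⟨l, hl, rfl⟩)
  · rintro h _ ⟨l, hl, rfl⟩
    exact (mk_mem_reduced_iff _).mpr h

theorem dim_eq {X : Set (RelOuterSpace n s)} (G : MarkedGraph n s) (hG : openPolysimplex G ⊆ X)
    (h : ∀ H : MarkedGraph n s, openPolysimplex H ⊆ X → H.polysimplexDim ≤ G.polysimplexDim) :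
    dim X = ((G.polysimplexDim : ℕ∞) : WithBot ℕ∞) :=
  le_antisymm (iSup₂_le fun H hH => by exact_mod_cast h H hH) (le_iSup₂_of_le G hG le_rfl)

end RelOuterSpace

theorem exists_equiv_sum_fin_of_injective {α β : Type*} [Fintype α] [Fintype β] {m : ℕ}
    (hm : Fintype.card β - Fintype.card α = m) {f : α → β} (hf : Function.Injective f) :
    ∃ b : α ⊕ Fin m ≃ β, ∀ a, b (Sum.inl a) = f a := by
  classical
  have hcard : Fintype.card ((Set.range f)ᶜ : Set β) = m := by
    rw [Fintype.card_compl_set, Set.card_range_of_injective hf, hm]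
  exact ⟨(Equiv.sumCongr (Equiv.ofInjective f hf) (Fintype.equivFinOfCardEq hcard).symm).trans
    (Equiv.Set.sumCompl _), fun _ => rfl⟩

theorem RelGraph.exists_markedGraph {n k : ℕ} {s : Fin k → ℕ} (G : RelGraph n s)
    (T : SpanningTree G.toFinGraph)
    (hT : ∀ p : Petal s, ∃ A e, G.petal p.1 p.2 = A ++ [(e, true)] ∧
      (∀ d ∈ A, T.IsTreeEdge d.1) ∧ ¬ T.IsTreeEdge e) :
    ∃ M : MarkedGraph n s, M.toRelGraph = G := by
  classical
  choose A lastEdge hpetal hA hlast using hT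
  have hinj : Function.Injective fun p => (⟨lastEdge p, hlast p⟩ : {e // ¬ T.IsTreeEdge e}) := by
    intro p p' h
    have hlast_eq : lastEdge p = lastEdge p' := congrArg Subtype.val h
    have hmem (p : Petal s) : lastEdge p ∈ (G.petal p.1 p.2).map Prod.fst := by simp [hpetal p]
    exact G.petal_unique (hmem p) (hlast_eq ▸ hmem p')
  have hcard : Fintype.card {e // ¬ T.IsTreeEdge e} - Fintype.card (Petal s) = n - ∑ j, s j := by
    have hcotree := T.card_not_isTreeEdge_add_card
    have hrank := G.rank_eq
    simp only [Fintype.card_sigma, Fintype.card_fin]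
    lia
  obtain ⟨b, hb⟩ := exists_equiv_sum_fin_of_injective hcard hinj
  have hmark : FreeGroup.lift (G.mark (fun j => T.path (G.base j))
      fun i => T.fundamentalLoop (b (Sum.inr i)).1) =
        T.fundamentalHom.comp (FreeGroup.freeGroupCongr b).toMonoidHom := by
    ext (p | i)
    · have hloop := T.conj_mk_eq_mk_fundamentalLoop (hpetal p ▸ G.petal_isPath p.1 p.2) (hA p)
      simpa [mark, SpanningTree.fundamentalHom, hb, hpetal p] using hloop
    · simp [mark, SpanningTree.fundamentalHom]
  refine ⟨{ G with
    center := T.root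
    stem := fun j => T.path (G.base j)
    stem_isPath := fun j => T.isPath_path _
    loop := fun i => T.fundamentalLoop (b (Sum.inr i)).1
    loop_isPath := fun i => T.isPath_fundamentalLoop _
    mark_injective := ?_
    mark_range := ?_ }, rfl⟩
  · rw [hmark]
    exact T.fundamentalHom_injective.comp (FreeGroup.freeGroupCongr b).injective
  · have hsurj : (FreeGroup.freeGroupCongr b).toMonoidHom.range = ⊤ :=
      MonoidHom.range_eq_top.mpr (FreeGroup.freeGroupCongr b).surjective
    rw [hmark, MonoidHom.range_comp, hsurj, ← MonoidHom.range_eq_map, T.range_fundamentalHom]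

theorem isAcyclic_of_height {W : Type*} {F : SimpleGraph W} (h : W → ℕ)
    (hne : ∀ a b, F.Adj a b → h a ≠ h b)
    (huniq : ∀ a b c, F.Adj a b → F.Adj a c → h b < h a → h c < h a → b = c) :
    F.IsAcyclic := by
  classical
  -- A highest vertex of a cycle would have two lower neighbours.
  intro v c hc
  obtain ⟨u, hu, hmax⟩ := c.support.toFinset.exists_max_image h ⟨v, by simp⟩
  rw [List.mem_toFinset] at hu
  have hrotate := hc.rotate hu
  have hlt : ∀ w, F.Adj u w → w ∈ (c.rotate u hu).support → h w < h u := by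
    intro w hw hmem
    refine lt_of_le_of_ne (hmax w ?_) (hne u w hw).symm
    rw [List.mem_toFinset]
    exact (SimpleGraph.Walk.mem_support_rotate_iff _ _ hu).mp hmem
  have hsnd := (c.rotate u hu).adj_snd hrotate.not_nil
  have hpen := ((c.rotate u hu).adj_penultimate hrotate.not_nil).symm
  exact hrotate.snd_ne_penultimate (huniq u _ _ hsnd hpen
    (hlt _ hsnd (SimpleGraph.Walk.getVert_mem_support _ _))
    (hlt _ hpen (SimpleGraph.Walk.getVert_mem_support _ _)))

theorem isAcyclic_incidence {J P : Type*} {on : J → P → Prop}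
    (h : {j | ¬ {w | on j w}.Subsingleton}.Subsingleton) :
    (SimpleGraph.fromRel fun a b : J ⊕ P =>
      ∃ j w, a = Sum.inl j ∧ b = Sum.inr w ∧ on j w).IsAcyclic := by
  classical
  have hadj {a b : J ⊕ P} (hab : (SimpleGraph.fromRel fun a b : J ⊕ P =>
      ∃ j w, a = Sum.inl j ∧ b = Sum.inr w ∧ on j w).Adj a b) : ∃ j w, on j w ∧
        ((a = Sum.inl j ∧ b = Sum.inr w) ∨ (a = Sum.inr w ∧ b = Sum.inl j)) := by
    obtain ⟨-, ⟨j, w, ha, hb, hw⟩ | ⟨j, w, hb, ha, hw⟩⟩ := hab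
    · exact ⟨j, w, hw, Or.inl ⟨ha, hb⟩⟩
    · exact ⟨j, w, hw, Or.inr ⟨ha, hb⟩⟩
  let height : J ⊕ P → ℕ :=
    Sum.elim (fun j => if {w | on j w}.Subsingleton then 2 else 0) fun _ => 1
  refine isAcyclic_of_height height ?_ ?_
  · intro a b hab
    obtain ⟨j, w, -, ⟨rfl, rfl⟩ | ⟨rfl, rfl⟩⟩ := hadj hab <;>
      simp only [height, Sum.elim_inl, Sum.elim_inr] <;> split_ifs <;> decide
  · intro a b c hab hac hb hc
    obtain ⟨j, w, hw, ⟨rfl, rfl⟩ | ⟨rfl, rfl⟩⟩ := hadj hab <;>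
      obtain ⟨j', w', hw', ⟨heq, rfl⟩ | ⟨heq, rfl⟩⟩ := hadj hac <;> cases heq
    · have hj : {w | on j w}.Subsingleton := by
        by_contra hj
        simp [height, hj] at hb
      rw [hj hw hw']
    · have hj (i) (hi : height (Sum.inl i) < height (Sum.inr w)) :
          ¬ {w | on i w}.Subsingleton := fun hsub => by
        simp [height, hsub] at hi
      rw [h (hj j hb) (hj j' hc)]

/-- A recipe for a relative graph without separating edges. The first circle of the `j`-th wedge
runs through the points `pt j 0, …, pt j (r j)`, in this order. The basepoint of the wedge is a
further vertex of this circle, between `pt j (r j)` and `pt j 0`, if `j` is detached, and `pt j 0`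
otherwise; the other circles of the wedge are loops at the basepoint. The edges outside the wedges
are indexed by `Extra`. -/
structure Blueprint (k : ℕ) where
  X : Type
  Extra : Type
  [finX : Fintype X]
  [finExtra : Fintype Extra]
  extraSrc : Extra → X
  extraTgt : Extra → X
  r : Fin k → ℕ
  pt : ∀ j, Fin (r j + 1) → X
  detached : Finset (Fin k)

attribute [instance] Blueprint.finX Blueprint.finExtra

namespace Blueprint

variable {k : ℕ} (D : Blueprint k) (t : Fin k → ℕ)

/-- The part of the graph of a blueprint that does not depend on the ranks of the wedges: the arcs
from `pt j i` to `pt j (i + 1)` and the edges outside the wedges. -/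
abbrev core : FinGraph where
  V := D.X
  E := (Σ j, Fin (D.r j)) ⊕ D.Extra
  src := Sum.elim (fun p => D.pt p.1 p.2.castSucc) D.extraSrc
  tgt := Sum.elim (fun p => D.pt p.1 p.2.succ) D.extraTgt

/-- The edges of the graph of a blueprint whose `j`-th wedge consists of `t j + 1` circles. The
first circle of the wedge is closed up by `final j`, and by `entry j` if `j` is detached. -/
inductive Edge
  | ofCore (e : D.core.E)
  | entry (j : D.detached)
  | final (j : Fin k)
  | loop (p : Σ j, Fin (t j))

/-- The edges of the graph of a blueprint, sorted by kind. -/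
def edgeEquiv : D.Edge t ≃ (D.core.E ⊕ D.detached) ⊕ (Fin k ⊕ Σ j, Fin (t j)) where
  toFun
    | .ofCore e => .inl (.inl e)
    | .entry j => .inl (.inr j)
    | .final j => .inr (.inl j)
    | .loop p => .inr (.inr p)
  invFun
    | .inl (.inl e) => .ofCore e
    | .inl (.inr j) => .entry j
    | .inr (.inl j) => .final j
    | .inr (.inr p) => .loop p
  left_inv := by rintro (_ | _ | _ | _) <;> rfl
  right_inv := by rintro ((_ | _) | (_ | _)) <;> rfl

noncomputable instance : Fintype (D.Edge t) := Fintype.ofEquiv _ (D.edgeEquiv t).symm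

theorem card_edge : Fintype.card (D.Edge t) =
    ∑ j, D.r j + Fintype.card D.Extra + D.detached.card + k + ∑ j, t j := by
  rw [Fintype.card_congr (D.edgeEquiv t)]
  simp [add_assoc]

/-- The basepoint of the `j`-th wedge in the graph of a blueprint. -/
def basepoint (j : Fin k) : D.X ⊕ D.detached :=
  if h : j ∈ D.detached then Sum.inr ⟨j, h⟩ else Sum.inl (D.pt j 0)

/-- The graph described by a blueprint, with `t j + 1` circles in the `j`-th wedge. -/
noncomputable abbrev graph : FinGraph where
  V := D.X ⊕ D.detached
  E := D.Edge t
  src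
    | .ofCore e => Sum.inl (D.core.src e)
    | .entry j => Sum.inr j
    | .final j => Sum.inl (D.pt j (Fin.last _))
    | .loop p => D.basepoint p.1
  tgt
    | .ofCore e => Sum.inl (D.core.tgt e)
    | .entry j => Sum.inl (D.pt j 0)
    | .final j => D.basepoint j
    | .loop p => D.basepoint p.1

/-- The inclusion of the core into the graph, on oriented edges. -/
def coreDart (d : D.core.Dart) : (D.graph t).Dart := (.ofCore d.1, d.2)

theorem start_coreDart (d : D.core.Dart) :
    (D.graph t).start (D.coreDart t d) = Sum.inl (D.core.start d) := by
  obtain ⟨e, _ | _⟩ := d <;> rfl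

theorem finish_coreDart (d : D.core.Dart) :
    (D.graph t).finish (D.coreDart t d) = Sum.inl (D.core.finish d) := by
  obtain ⟨e, _ | _⟩ := d <;> rfl

theorem not_isSeparating_ofCore {e : D.core.E} (he : ¬ D.core.IsSeparating e) :
    ¬ (D.graph t).IsSeparating (.ofCore e) :=
  not_isSeparating_of_map (φ := D.coreDart t) (d := (e, true)) (D.start_coreDart t)
    (D.finish_coreDart t) (fun _ h => Edge.ofCore.inj h) he

/-- The extension of a spanning tree of the core of a blueprint to its graph. -/
def spanningTree (T : SpanningTree D.core) : SpanningTree (D.graph t) where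
  root := Sum.inl T.root
  parent
    | ⟨Sum.inl x, hx⟩ => D.coreDart t (T.parent ⟨x, fun h => hx (congrArg Sum.inl h)⟩)
    | ⟨Sum.inr j, _⟩ => (.entry j, false)
  height := Sum.elim T.height fun j => T.height (D.pt j 0) + 1
  finish_parent := by
    rintro ⟨x | j, hx⟩
    · exact (D.finish_coreDart t _).trans (congrArg Sum.inl (T.finish_parent _))
    · rfl
  height_lt := by
    rintro ⟨x | j, hx⟩
    · change Sum.elim _ _ ((D.graph t).start (D.coreDart t _)) < _
      rw [start_coreDart]
      exact T.height_lt ⟨x, fun h => hx (congrArg Sum.inl h)⟩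
    · exact Nat.lt_succ_self _

theorem isTreeEdge_ofCore {T : SpanningTree D.core} {e : D.core.E} (he : T.IsTreeEdge e) :
    (D.spanningTree t T).IsTreeEdge (.ofCore e) := by
  obtain ⟨⟨x, hx⟩, rfl⟩ := he
  exact ⟨⟨Sum.inl x, fun h => hx (Sum.inl.inj h)⟩, rfl⟩

theorem isTreeEdge_entry (T : SpanningTree D.core) (j : D.detached) :
    (D.spanningTree t T).IsTreeEdge (.entry j) :=
  ⟨⟨Sum.inr j, Sum.inr_ne_inl⟩, rfl⟩

theorem not_isTreeEdge_final (T : SpanningTree D.core) (j : Fin k) :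
    ¬ (D.spanningTree t T).IsTreeEdge (.final j) := by
  rintro ⟨⟨_ | _, _⟩, h⟩ <;> cases h

theorem not_isTreeEdge_loop (T : SpanningTree D.core) (p : Σ j, Fin (t j)) :
    ¬ (D.spanningTree t T).IsTreeEdge (.loop p) := by
  rintro ⟨⟨_ | _, _⟩, h⟩ <;> cases h

/-- The edges from the basepoint of the `j`-th wedge to `pt j 0`. -/
def entryEdges (j : Fin k) : List (D.Edge t) :=
  if h : j ∈ D.detached then [.entry ⟨j, h⟩] else []

/-- The edges from `pt j 0` to `pt j (r j)` along the first circle of the `j`-th wedge. -/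
def arcEdges (j : Fin k) : List (D.Edge t) := List.ofFn fun i => .ofCore (.inl ⟨j, i⟩)

/-- The edges of the circles of the `j`-th wedge. -/
def circle (j : Fin k) : Fin (t j + 1) → List (D.Edge t) :=
  Fin.cons (D.entryEdges t j ++ D.arcEdges t j ++ [.final j]) fun i => [.loop ⟨j, i⟩]

theorem circle_zero (j : Fin k) :
    D.circle t j 0 = D.entryEdges t j ++ D.arcEdges t j ++ [.final j] := rfl

theorem circle_succ (j : Fin k) (i : Fin (t j)) : D.circle t j i.succ = [.loop ⟨j, i⟩] := rfl

theorem circle_ne_nil (j : Fin k) (i : Fin (t j + 1)) : D.circle t j i ≠ [] := by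
  cases i using Fin.cases <;> simp [circle_zero, circle_succ]

/-- The circles of the `j`-th wedge, as edge paths. -/
def petal (j : Fin k) (i : Fin (t j + 1)) : List (D.graph t).Dart :=
  (D.circle t j i).map fun e => (e, true)

theorem map_fst_petal (j : Fin k) (i : Fin (t j + 1)) :
    (D.petal t j i).map Prod.fst = D.circle t j i := by
  simp [petal, Function.comp_def]

theorem map_start_petal (j : Fin k) (i : Fin (t j + 1)) :
    (D.petal t j i).map (D.graph t).start = (D.circle t j i).map (D.graph t).src :=
  List.map_map

theorem isPath_petal (j : Fin k) (i : Fin (t j + 1)) :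
    (D.graph t).IsPath (D.basepoint j) (D.petal t j i) (D.basepoint j) := by
  cases i using Fin.cases with
  | zero =>
    have hentry : (D.graph t).IsPath (D.basepoint j)
        ((D.entryEdges t j).map fun e => (e, true)) (Sum.inl (D.pt j 0)) := by
      unfold basepoint entryEdges
      split_ifs with h
      · exact ⟨rfl, rfl⟩
      · rfl
    have harcs : (D.graph t).IsPath (Sum.inl (D.pt j 0))
        ((D.arcEdges t j).map fun e => (e, true)) (Sum.inl (D.pt j (Fin.last _))) := by
      rw [arcEdges, List.map_ofFn]
      exact isPath_ofFn (Γ := D.graph t) (f := fun i => Sum.inl (D.pt j i)) (fun _ => rfl)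
        fun _ => rfl
    rw [petal, circle_zero, List.map_append, List.map_append]
    exact (hentry.append harcs).append ⟨rfl, rfl⟩
  | succ i => exact ⟨rfl, rfl⟩

/-- The circle containing an edge of the graph of a blueprint, if there is one. -/
def owner {D : Blueprint k} {t : Fin k → ℕ} : D.Edge t → Option (Petal fun j => t j + 1)
  | .ofCore (.inl p) => some ⟨p.1, 0⟩
  | .ofCore (.inr _) => none
  | .entry j => some ⟨j, 0⟩
  | .final j => some ⟨j, 0⟩
  | .loop p => some ⟨p.1, p.2.succ⟩

theorem owner_eq_of_mem {j : Fin k} {i : Fin (t j + 1)} {e : D.Edge t}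
    (he : e ∈ D.circle t j i) : owner e = some ⟨j, i⟩ := by
  cases i using Fin.cases with
  | zero =>
    rw [circle_zero, List.mem_append, List.mem_append, arcEdges, List.mem_ofFn,
      List.mem_singleton] at he
    rcases he with (he | ⟨i, rfl⟩) | rfl
    · unfold entryEdges at he
      split_ifs at he with h
      · rw [List.mem_singleton.mp he]
        rfl
      · cases he
    · rfl
    · rfl
  | succ i =>
    rw [List.mem_singleton.mp he]
    rfl

theorem mem_circle_iff {e : D.Edge t} {p : Petal fun j => t j + 1} :
    e ∈ D.circle t p.1 p.2 ↔ owner e = some p := by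
  refine ⟨D.owner_eq_of_mem t, fun h => ?_⟩
  rcases e with (q | e) | j | j | q
  · obtain rfl := Option.some.inj h
    simp [circle_zero, arcEdges]
  · cases h
  · obtain rfl := Option.some.inj h
    simp [circle_zero, entryEdges, j.2]
  · obtain rfl := Option.some.inj h
    simp [circle_zero]
  · obtain rfl := Option.some.inj h
    exact List.mem_singleton_self _

theorem map_src_circle_zero (j : Fin k) : (D.circle t j 0).map (D.graph t).src =
    (D.entryEdges t j).map (D.graph t).src ++
      List.ofFn (n := D.r j + 1) fun i => Sum.inl (D.pt j i) := by
  rw [circle_zero, arcEdges, List.append_assoc, List.map_append, List.map_append, List.map_ofFn,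
    List.ofFn_succ', List.concat_eq_append]
  rfl

/-- The vertex `v` of the graph of a blueprint lies on the `j`-th wedge. -/
def OnWedge {D : Blueprint k} (j : Fin k) : D.X ⊕ D.detached → Prop :=
  Sum.elim (fun x => x ∈ Set.range (D.pt j)) fun j' => j'.1 = j

/-- The points on the `j`-th wedge in which it meets another wedge. -/
def meeting (j : Fin k) : Set D.X :=
  {x | x ∈ Set.range (D.pt j) ∧ ∃ j', j' ≠ j ∧ x ∈ Set.range (D.pt j')}

theorem onWedge_basepoint (j : Fin k) : OnWedge j (D.basepoint j) := by
  unfold basepoint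
  split_ifs
  · rfl
  · exact ⟨0, rfl⟩

theorem subsingleton_setOf_onWedge {j : Fin k} (h : (D.meeting j).Subsingleton) :
    {v : D.X ⊕ D.detached | OnWedge j v ∧ ∃ j', j' ≠ j ∧ OnWedge j' v}.Subsingleton := by
  refine (h.image Sum.inl).anti ?_
  rintro (x | i) ⟨hj, j', hne, hj'⟩
  · exact ⟨x, ⟨hj, j', hne, hj'⟩, rfl⟩
  · exact absurd (hj'.symm.trans hj) hne

theorem onWedge_of_mem {j : Fin k} {i : Fin (t j + 1)} {v : (D.graph t).V}
    (hv : v ∈ (D.petal t j i).map (D.graph t).start) : OnWedge j v := by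
  rw [map_start_petal] at hv
  cases i using Fin.cases with
  | zero =>
    rw [map_src_circle_zero, List.mem_append, List.mem_ofFn] at hv
    rcases hv with hv | ⟨i, rfl⟩
    · unfold entryEdges at hv
      split_ifs at hv with h
      · rw [List.mem_singleton.mp hv]
        rfl
      · cases hv
    · exact ⟨i, rfl⟩
  | succ i =>
    rw [List.mem_singleton.mp hv]
    exact D.onWedge_basepoint j

theorem nodup_map_src_circle (hpt : ∀ j, Function.Injective (D.pt j)) (j : Fin k)
    (i : Fin (t j + 1)) : ((D.circle t j i).map (D.graph t).src).Nodup := by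
  cases i using Fin.cases with
  | zero =>
    have hpts : (List.ofFn (n := D.r j + 1) fun i =>
        (Sum.inl (D.pt j i) : D.X ⊕ D.detached)).Nodup :=
      List.nodup_ofFn.mpr (Sum.inl_injective.comp (hpt j))
    rw [map_src_circle_zero]
    unfold entryEdges
    split_ifs with h
    · exact List.nodup_cons.mpr ⟨by simp [List.mem_ofFn], hpts⟩
    · exact hpts
  | succ i => exact List.nodup_singleton _

theorem exists_petal_eq_append {T : SpanningTree D.core}
    (hT : ∀ p, T.IsTreeEdge (Sum.inl p)) (j : Fin k) (i : Fin (t j + 1)) :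
    ∃ A e, D.petal t j i = A ++ [(e, true)] ∧
      (∀ d ∈ A, (D.spanningTree t T).IsTreeEdge d.1) ∧ ¬ (D.spanningTree t T).IsTreeEdge e := by
  cases i using Fin.cases with
  | zero =>
    refine ⟨(D.entryEdges t j ++ D.arcEdges t j).map fun e => (e, true), .final j, ?_, ?_,
      D.not_isTreeEdge_final t T j⟩
    · rw [petal, circle_zero, List.map_append]
      rfl
    · intro d hd
      obtain ⟨e, he, rfl⟩ := List.mem_map.mp hd
      rw [List.mem_append, arcEdges, List.mem_ofFn] at he
      rcases he with he | ⟨i, rfl⟩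
      · unfold entryEdges at he
        split_ifs at he with h
        · rw [List.mem_singleton.mp he]
          exact D.isTreeEdge_entry t T ⟨j, h⟩
        · cases he
      · exact D.isTreeEdge_ofCore t (hT ⟨j, i⟩)
  | succ i => exact ⟨[], .loop ⟨j, i⟩, rfl, by simp, D.not_isTreeEdge_loop t T _⟩

theorem not_isSeparating_graph (hpt : ∀ j, Function.Injective (D.pt j))
    (hExtra : ∀ e, ¬ D.core.IsSeparating (Sum.inr e)) (e : D.Edge t) :
    ¬ (D.graph t).IsSeparating e := by
  cases howner : owner e with
  | none =>
    rcases e with (p | e) | j | j | p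
    · cases howner
    · exact D.not_isSeparating_ofCore t (hExtra e)
    all_goals cases howner
  | some p =>
    refine not_isSeparating_of_mem (D.isPath_petal t p.1 p.2) ?_ ?_ <;> rw [map_fst_petal]
    · exact (D.nodup_map_src_circle t hpt p.1 p.2).of_map
    · exact (D.mem_circle_iff t).mpr howner

/-- The conditions under which the graph of a blueprint is a relative graph of rank `n`. The last
one makes the dual graph a forest: all wedges but one have degree at most `1` in it. -/
structure Valid (D : Blueprint k) (n : ℕ) (t : Fin k → ℕ) : Prop where
  one_le_of_mem_detached : ∀ j ∈ D.detached, 1 ≤ t j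
  rank_eq : ∑ j, D.r j + ∑ j, t j + k + Fintype.card D.Extra + 1 = Fintype.card D.X + n
  pt_injective : ∀ j, Function.Injective (D.pt j)
  three_le_valence : ∀ x, 3 ≤ (D.graph t).valence (Sum.inl x)
  meeting_subsingleton : {j | ¬ (D.meeting j).Subsingleton}.Subsingleton

variable {D t}

theorem three_le_valence_of_mem_circle (hpt : ∀ j, Function.Injective (D.pt j)) {j : Fin k}
    {v : (D.graph t).V} (hv : v ∈ (D.circle t j 0).map (D.graph t).src) {d : (D.graph t).Dart}
    (hd : (D.graph t).start d = v) (hne : owner d.1 ≠ some ⟨j, 0⟩) :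
    3 ≤ (D.graph t).valence v := by
  refine (D.isPath_petal t j 0).three_le_valence ?_ ?_ hd ?_
  · rw [map_fst_petal]
    exact (D.nodup_map_src_circle t hpt j 0).of_map
  · rwa [map_start_petal]
  · rwa [map_fst_petal, D.mem_circle_iff t (p := ⟨j, 0⟩)]

theorem three_le_valence_pt (hpt : ∀ j, Function.Injective (D.pt j)) (j : Fin k)
    (i : Fin (D.r j + 1)) {d : (D.graph t).Dart}
    (hd : (D.graph t).start d = Sum.inl (D.pt j i)) (hne : owner d.1 ≠ some ⟨j, 0⟩) :
    3 ≤ (D.graph t).valence (Sum.inl (D.pt j i)) := by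
  refine three_le_valence_of_mem_circle hpt ?_ hd hne
  rw [map_src_circle_zero]
  exact List.mem_append_right _ (List.mem_ofFn.mpr ⟨i, rfl⟩)

namespace Valid

variable {n : ℕ}

theorem three_le_valence_graph (hD : D.Valid n t) (v : (D.graph t).V) :
    3 ≤ (D.graph t).valence v := by
  rcases v with x | ⟨j, hj⟩
  · exact hD.three_le_valence x
  · have hbase : D.basepoint j = Sum.inr ⟨j, hj⟩ := dif_pos hj
    refine three_le_valence_of_mem_circle hD.pt_injective (j := j) ?_
      (d := (.loop ⟨j, ⟨0, hD.one_le_of_mem_detached j hj⟩⟩, true)) hbase ?_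
    · rw [← map_start_petal, ← hbase]
      exact (D.isPath_petal t j 0).base_mem (by simpa [petal] using D.circle_ne_nil t j 0)
    · simp [owner]

theorem isAcyclic_dual (hD : D.Valid n t) : (SimpleGraph.fromRel
    (fun (a b : Fin k ⊕ {v : (D.graph t).V // ∃ j j', j ≠ j' ∧
        (∃ i, v ∈ (D.petal t j i).map (D.graph t).start) ∧
        ∃ i, v ∈ (D.petal t j' i).map (D.graph t).start}) =>
      ∃ j w, a = Sum.inl j ∧ b = Sum.inr w ∧
        ∃ i, w.1 ∈ (D.petal t j i).map (D.graph t).start)).IsAcyclic := by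
  refine isAcyclic_incidence (on := fun j (w : {v : (D.graph t).V // ∃ j j', j ≠ j' ∧
    (∃ i, v ∈ (D.petal t j i).map (D.graph t).start) ∧
    ∃ i, v ∈ (D.petal t j' i).map (D.graph t).start}) =>
      ∃ i, w.1 ∈ (D.petal t j i).map (D.graph t).start) (hD.meeting_subsingleton.anti ?_)
  refine fun j hj hsub => hj (((D.subsingleton_setOf_onWedge hsub).preimage
    Subtype.val_injective).anti ?_)
  rintro ⟨v, j₁, j₂, hne, ⟨i₁, h₁⟩, ⟨i₂, h₂⟩⟩ ⟨i, hi⟩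
  refine ⟨D.onWedge_of_mem t hi, ?_⟩
  by_cases hj₁ : j₁ = j
  · exact ⟨j₂, fun hj₂ => hne (hj₁.trans hj₂.symm), D.onWedge_of_mem t h₂⟩
  · exact ⟨j₁, hj₁, D.onWedge_of_mem t h₁⟩

theorem wedge_vertices_inter (hD : D.Valid n t) {j j' : Fin k} (hne : j ≠ j') :
    {v : (D.graph t).V | (∃ i, v ∈ (D.petal t j i).map (D.graph t).start) ∧
      ∃ i, v ∈ (D.petal t j' i).map (D.graph t).start}.Subsingleton := by
  by_cases hj : (D.meeting j).Subsingleton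
  · refine (D.subsingleton_setOf_onWedge hj).anti ?_
    rintro v ⟨⟨i, hi⟩, ⟨i', hi'⟩⟩
    exact ⟨D.onWedge_of_mem t hi, j', hne.symm, D.onWedge_of_mem t hi'⟩
  · have hj' : (D.meeting j').Subsingleton :=
      by_contra fun hj' => hne (hD.meeting_subsingleton hj hj')
    refine (D.subsingleton_setOf_onWedge hj').anti ?_
    rintro v ⟨⟨i, hi⟩, ⟨i', hi'⟩⟩
    exact ⟨D.onWedge_of_mem t hi', j, hne, D.onWedge_of_mem t hi⟩

/-- The relative graph described by a valid blueprint. -/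
noncomputable def relGraph (hD : D.Valid n t) (hconn : (D.graph t).Connected) :
    RelGraph n fun j => t j + 1 where
  toFinGraph := D.graph t
  connected := hconn
  rank_eq := by
    have hrank := hD.rank_eq
    rw [D.card_edge t, Fintype.card_sum, Fintype.card_coe]
    lia
  three_le_valence := hD.three_le_valence_graph
  base := D.basepoint
  petal := D.petal t
  petal_isPath := D.isPath_petal t
  petal_ne_nil j i := by simpa [petal] using D.circle_ne_nil t j i
  petal_vertices_nodup j i := by
    rw [map_start_petal]
    exact D.nodup_map_src_circle t hD.pt_injective j i
  petal_edges_nodup j i := by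
    rw [map_fst_petal]
    exact (D.nodup_map_src_circle t hD.pt_injective j i).of_map
  petal_vertices_inter j i i' hne v hv hv' := by
    rcases i.eq_zero_or_eq_succ with rfl | ⟨i, rfl⟩
    · obtain ⟨i', rfl⟩ := Fin.exists_succ_eq_of_ne_zero hne.symm
      exact List.mem_singleton.mp hv'
    · exact List.mem_singleton.mp hv
  petal_edges_disjoint j i i' hne e he he' := by
    rw [map_fst_petal] at he he'
    have howner := (D.owner_eq_of_mem t he).symm.trans (D.owner_eq_of_mem t he')
    exact hne (by simpa using howner)
  wedge_edges_disjoint j j' hne i i' e he he' := by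
    rw [map_fst_petal] at he he'
    have howner := (D.owner_eq_of_mem t he).symm.trans (D.owner_eq_of_mem t he')
    exact hne (congrArg Sigma.fst (Option.some.inj howner))
  wedge_vertices_inter j j' hne := hD.wedge_vertices_inter hne
  dual_isAcyclic := hD.isAcyclic_dual

theorem exists_markedGraph (hD : D.Valid n t) (T : SpanningTree D.core)
    (hT : ∀ p, T.IsTreeEdge (Sum.inl p))
    (hExtra : ∀ e, ¬ D.core.IsSeparating (Sum.inr e)) :
    ∃ G : MarkedGraph n fun j => t j + 1, (∀ e, ¬ G.IsSeparating e) ∧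
      Fintype.card G.E = ∑ j, D.r j + Fintype.card D.Extra + D.detached.card + k + ∑ j, t j := by
  obtain ⟨G, hG⟩ := (hD.relGraph (D.spanningTree t T).connected).exists_markedGraph
    (D.spanningTree t T) fun p => D.exists_petal_eq_append t hT p.1 p.2
  refine ⟨G, ?_, ?_⟩
  · rw [hG]
    exact D.not_isSeparating_graph t hD.pt_injective hExtra
  · rw [hG]
    exact D.card_edge t

end Valid

theorem subsingleton_meeting_of_forall_pt_eq {k : ℕ} {D : Blueprint k} {j : Fin k} {x : D.X}
    (h : ∀ i, D.pt j i = x) : (D.meeting j).Subsingleton := by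
  rintro _ ⟨⟨i, rfl⟩, -⟩ _ ⟨⟨i', rfl⟩, -⟩
  rw [h, h]

/-- The rose: a single wedge, and no edges outside of it. -/
abbrev rose : Blueprint 1 where
  X := Unit
  Extra := Empty
  extraSrc := Empty.elim
  extraTgt := Empty.elim
  r _ := 0
  pt _ _ := ()
  detached := ∅

theorem rose_pt_injective (j : Fin 1) : Function.Injective (rose.pt j) :=
  fun i i' _ => Subsingleton.elim (α := Fin 1) i i'

theorem valid_rose {n : ℕ} {t : Fin 1 → ℕ} (hn : 2 ≤ n) (h : n = t 0 + 1) : rose.Valid n t where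
  one_le_of_mem_detached := by simp
  rank_eq := by
    simp only [h, Finset.sum_const_zero, Fin.sum_univ_one, Fintype.card_empty, Fintype.card_unit]
    lia
  pt_injective := rose_pt_injective
  three_le_valence _ :=
    three_le_valence_pt rose_pt_injective 0 0 (d := (.loop ⟨0, ⟨0, by lia⟩⟩, true)) rfl
      (by simp [owner])
  meeting_subsingleton := Set.subsingleton_of_subsingleton

/-- The spanning tree of the core of the rose, which is a point. -/
def roseTree : SpanningTree rose.core where
  root := ()
  parent v := absurd rfl v.2
  height _ := 0
  finish_parent v := absurd rfl v.2
  height_lt v := absurd rfl v.2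

/-- The star: the first circle of the wedge `0` runs through `k + 1` points, and each of them lies
on one further wedge. -/
abbrev star {k : ℕ} (t : Fin (k + 2) → ℕ) : Blueprint (k + 2) where
  X := Fin (k + 1)
  Extra := Empty
  extraSrc := Empty.elim
  extraTgt := Empty.elim
  r := Fin.cons k 0
  pt := Fin.cases id fun j _ => j
  detached := {j | t j ≠ 0}

theorem star_pt_injective {k : ℕ} (t : Fin (k + 2) → ℕ) (j : Fin (k + 2)) :
    Function.Injective ((star t).pt j) := by
  cases j using Fin.cases with
  | zero => exact Function.injective_id
  | succ j =>
    intro i i' _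
    exact Subsingleton.elim (α := Fin 1) i i'

theorem valid_star {k : ℕ} (t : Fin (k + 2) → ℕ) : (star t).Valid (∑ j, (t j + 1)) t where
  one_le_of_mem_detached j hj := Nat.one_le_iff_ne_zero.mpr (Finset.mem_filter.mp hj).2
  rank_eq := by
    have hr : ∑ j, (star t).r j = k := by simp [Fin.sum_univ_succ (n := k + 1)]
    simp only [hr, Finset.sum_add_distrib, Finset.sum_const, Finset.card_univ, Fintype.card_fin,
      Fintype.card_empty, smul_eq_mul, mul_one]
    lia
  pt_injective := star_pt_injective t
  three_le_valence x :=
    three_le_valence_pt (star_pt_injective t) 0 x (d := (.final x.succ, true)) rfl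
      (by simp [owner])
  meeting_subsingleton := by
    have hzero {j : Fin (k + 2)} (hj : ¬ ((star t).meeting j).Subsingleton) : j = 0 := by
      by_contra hne
      obtain ⟨j, rfl⟩ := Fin.exists_succ_eq_of_ne_zero hne
      exact hj (subsingleton_meeting_of_forall_pt_eq fun _ => rfl)
    exact fun j hj j' hj' => (hzero hj).trans (hzero hj').symm

/-- The spanning tree of the core of the star that runs along the first circle of the wedge `0`. -/
def starTree {k : ℕ} (t : Fin (k + 2) → ℕ) : SpanningTree (star t).core where
  root := (0 : Fin (k + 1))
  parent v := (.inl ⟨0, v.1.pred v.2⟩, true)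
  height x := x.val
  finish_parent v := v.1.succ_pred v.2
  height_lt v := by
    change (v.1.pred v.2).val < v.1.val
    rw [Fin.val_pred]
    exact Nat.sub_one_lt (Fin.val_ne_zero_iff.mpr v.2)

theorem isTreeEdge_starTree {k : ℕ} (t : Fin (k + 2) → ℕ) (p : Σ j, Fin ((star t).r j)) :
    (starTree t).IsTreeEdge (.inl p) := by
  obtain ⟨j, i⟩ := p
  cases j using Fin.cases with
  | zero => exact ⟨⟨Fin.succ i, Fin.succ_ne_zero i⟩, rfl⟩
  | succ j => exact i.elim0

section Necklace

variable {k b : ℕ} [NeZero (k + b)]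

/-- The necklace: a ring in which `k` wedges, passed between two points of their first circle,
and `b` digons are joined by `k + b` links. -/
abbrev necklace (b : ℕ) [NeZero (k + b)] (t : Fin k → ℕ) : Blueprint k where
  X := Fin (k + b) × Bool
  Extra := Fin (k + b) ⊕ Fin b × Bool
  extraSrc := Sum.elim (fun g => (g, true)) fun p => (Fin.natAdd k p.1, false)
  extraTgt := Sum.elim (fun g => (g + 1, false)) fun p => (Fin.natAdd k p.1, true)
  r _ := 1
  pt j i := (Fin.castAdd b j, finTwoEquiv i)
  detached := {j | t j ≠ 0}

variable (t : Fin k → ℕ)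

theorem necklace_pt_injective (j : Fin k) : Function.Injective ((necklace b t).pt j) :=
  (Prod.mk_right_injective _).comp finTwoEquiv.injective

theorem meeting_necklace (j : Fin k) : (necklace b t).meeting j = ∅ := by
  refine Set.eq_empty_of_forall_notMem ?_
  rintro _ ⟨⟨i, rfl⟩, j', hne, ⟨i', h⟩⟩
  exact hne (Fin.castAdd_injective k b (congrArg Prod.fst h))

theorem three_le_valence_necklace (x : (necklace b t).X) :
    3 ≤ ((necklace b t).graph t).valence (Sum.inl x) := by
  obtain ⟨g, c⟩ := x
  obtain ⟨d, g', hlink, hd⟩ : ∃ (d : ((necklace b t).graph t).Dart) (g' : Fin (k + b)),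
      d.1 = .ofCore (.inr (.inl g')) ∧ ((necklace b t).graph t).start d = Sum.inl (g, c) := by
    cases c
    · exact ⟨(.ofCore (.inr (.inl (g - 1))), false), _, rfl,
        congrArg (fun h => Sum.inl (h, false)) (sub_add_cancel g 1)⟩
    · exact ⟨(.ofCore (.inr (.inl g)), true), _, rfl, rfl⟩
  cases g using Fin.addCases with
  | left j =>
    have hpt : (necklace b t).pt j (finTwoEquiv.symm c) = (Fin.castAdd b j, c) :=
      congrArg (Prod.mk _) (finTwoEquiv.apply_symm_apply c)
    rw [← hpt]
    exact three_le_valence_pt (necklace_pt_injective t) j _ (hd.trans (congrArg Sum.inl hpt.symm))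
      (by simp [hlink, owner])
  | right i =>
    have hdigon (c' : Bool) : ((necklace b t).graph t).start (.ofCore (.inr (.inr (i, c'))), !c) =
        Sum.inl (Fin.natAdd k i, c) := by
      cases c <;> rfl
    refine FinGraph.three_le_valence (hdigon false) (hdigon true) hd ?_ ?_ ?_
    · simp
    all_goals
      rintro rfl
      cases hlink

theorem valid_necklace : (necklace b t).Valid (∑ j, (t j + 1) + b + 1) t where
  one_le_of_mem_detached j hj := Nat.one_le_iff_ne_zero.mpr (Finset.mem_filter.mp hj).2
  rank_eq := by
    simp only [Finset.sum_add_distrib, Finset.sum_const, Finset.card_univ, Fintype.card_fin,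
      smul_eq_mul, mul_one, Fintype.card_sum, Fintype.card_prod, Fintype.card_bool]
    lia
  pt_injective := necklace_pt_injective t
  three_le_valence := three_le_valence_necklace t
  meeting_subsingleton j hj := absurd (by simp [meeting_necklace]) hj

/-- An edge from `(g, false)` to `(g, true)` in the necklace; `c` selects one if there are two. -/
def crossing (c : Bool) : Fin (k + b) → (necklace b t).core.E :=
  Fin.addCases (fun j => .inl ⟨j, 0⟩) fun i => .inr (.inr (i, c))

theorem src_crossing (c : Bool) (g : Fin (k + b)) :
    (necklace b t).core.src (crossing t c g) = (g, false) := by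
  cases g using Fin.addCases <;> simp [crossing, finTwoEquiv]

theorem tgt_crossing (c : Bool) (g : Fin (k + b)) :
    (necklace b t).core.tgt (crossing t c g) = (g, true) := by
  cases g using Fin.addCases <;> simp [crossing, finTwoEquiv]

/-- The spanning tree of the core of the necklace that runs once around the ring, from
`(g₀, false)` to `(g₀ - 1, true)`. -/
def necklaceTree (g₀ : Fin (k + b)) (c : Bool) : SpanningTree (necklace b t).core where
  root := (g₀, false)
  parent
    | ⟨(g, true), _⟩ => (crossing t c g, true)
    | ⟨(g, false), _⟩ => (.inr (.inl (g - 1)), true)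
  height x := 2 * (x.1 - g₀).val + x.2.toNat
  finish_parent := by
    rintro ⟨⟨g, _ | _⟩, _⟩
    · exact congrArg (fun h => (h, false)) (sub_add_cancel g 1)
    · exact tgt_crossing t c g
  height_lt := by
    rintro ⟨⟨g, _ | _⟩, hg⟩
    · have hne : g - g₀ ≠ 0 := fun h => hg (congrArg (fun h => (h, false)) (sub_eq_zero.mp h))
      have hval : (g - 1 - g₀).val + 1 = (g - g₀).val := by
        rw [sub_right_comm, Fin.val_sub_one_of_ne_zero hne]
        exact Nat.sub_add_cancel (Nat.one_le_iff_ne_zero.mpr (Fin.val_ne_zero_iff.mpr hne))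
      change 2 * (g - 1 - g₀).val + 1 < 2 * (g - g₀).val
      lia
    · change (fun x : Fin (k + b) × Bool => 2 * (x.1 - g₀).val + x.2.toNat)
        ((necklace b t).core.src (crossing t c g)) < _
      rw [src_crossing]
      exact Nat.lt_succ_self _

variable {t}

theorem isTreeEdge_necklaceTree (g₀ : Fin (k + b)) (c : Bool)
    (p : Σ j, Fin ((necklace b t).r j)) : (necklaceTree t g₀ c).IsTreeEdge (.inl p) := by
  obtain ⟨j, i⟩ := p
  refine ⟨⟨(Fin.castAdd b j, true), by simp [necklaceTree]⟩, ?_⟩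
  rw [Subsingleton.elim (α := Fin 1) i 0]
  change crossing t c _ = _
  rw [crossing, Fin.addCases_left]

theorem not_isSeparating_core_necklace (e : (necklace b t).Extra) :
    ¬ (necklace b t).core.IsSeparating (.inr e) := by
  rcases e with g | ⟨i, c⟩
  · refine (necklaceTree t (g + 1) true).not_isSeparating_of_not_isTreeEdge ?_
    rintro ⟨⟨⟨x, _ | _⟩, hx⟩, h⟩
    · obtain rfl : x - 1 = g := Sum.inl.inj (Sum.inr.inj h)
      exact hx (congrArg (fun h => (h, false)) (sub_add_cancel x 1).symm)
    · change crossing t true x = _ at h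
      cases x using Fin.addCases <;> simp [crossing] at h
  · refine (necklaceTree t 0 (!c)).not_isSeparating_of_not_isTreeEdge ?_
    rintro ⟨⟨⟨x, _ | _⟩, hx⟩, h⟩
    · cases h
    · change crossing t (!c) x = _ at h
      cases x using Fin.addCases <;> simp [crossing] at h

end Necklace

end Blueprint

theorem card_filter_ne_zero_add_card_filter_eq_one {k : ℕ} (t : Fin k → ℕ) :
    (Finset.univ.filter fun j => t j ≠ 0).card +
      (Finset.univ.filter fun j => t j + 1 = 1).card = k := by
  simpa [add_comm] using Finset.card_filter_add_card_filter_not (s := Finset.univ) (t · = 0)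

theorem exists_card_edges_eq_of_one_wedge {n : ℕ} (hn : 2 ≤ n) {t : Fin 1 → ℕ}
    (h : n = ∑ j, (t j + 1)) : ∃ G : MarkedGraph n fun j => t j + 1, (∀ e, ¬ G.IsSeparating e) ∧
      Fintype.card G.E + (Finset.univ.filter fun j => t j + 1 = 1).card + 2 = ∑ j, t j + 3 := by
  rw [Fin.sum_univ_one] at h
  obtain ⟨G, hG, hcard⟩ := (Blueprint.valid_rose hn h).exists_markedGraph Blueprint.roseTree
    (fun p => p.2.elim0) (fun e => e.elim)
  have ht : t 0 ≠ 0 := by lia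
  have hfilter : (Finset.univ.filter fun j => t j + 1 = 1) = ∅ :=
    Finset.filter_eq_empty_iff.mpr fun j _ => by simpa [Subsingleton.elim j 0] using ht
  refine ⟨G, hG, ?_⟩
  simp only [hcard, hfilter, Finset.sum_const_zero, Fintype.card_empty, Finset.card_empty]
  lia

theorem exists_card_edges_eq_of_two_le_wedges {k : ℕ} (t : Fin (k + 2) → ℕ) :
    ∃ G : MarkedGraph (∑ j, (t j + 1)) fun j => t j + 1, (∀ e, ¬ G.IsSeparating e) ∧
      Fintype.card G.E + (Finset.univ.filter fun j => t j + 1 = 1).card + 2 =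
        ∑ j, t j + 3 * (k + 2) := by
  obtain ⟨G, hG, hcard⟩ := (Blueprint.valid_star t).exists_markedGraph (Blueprint.starTree t)
    (Blueprint.isTreeEdge_starTree t) (fun e => e.elim)
  have hsplit := card_filter_ne_zero_add_card_filter_eq_one t
  have hr : ∑ j, (Blueprint.star t).r j = k := by simp [Fin.sum_univ_succ (n := k + 1)]
  simp only [hr, Fintype.card_empty] at hcard
  exact ⟨G, hG, by lia⟩

theorem exists_card_edges_eq_of_lt_rank {k : ℕ} (t : Fin k → ℕ) (b : ℕ) (h : k + b ≠ 0) :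
    ∃ G : MarkedGraph (∑ j, (t j + 1) + b + 1) fun j => t j + 1, (∀ e, ¬ G.IsSeparating e) ∧
      Fintype.card G.E + (Finset.univ.filter fun j => t j + 1 = 1).card =
        ∑ j, t j + 4 * k + 3 * b := by
  have : NeZero (k + b) := ⟨h⟩
  obtain ⟨G, hG, hcard⟩ := (Blueprint.valid_necklace (b := b) t).exists_markedGraph
    (Blueprint.necklaceTree t 0 true) (Blueprint.isTreeEdge_necklaceTree 0 true)
    Blueprint.not_isSeparating_core_necklace
  have hsplit := card_filter_ne_zero_add_card_filter_eq_one t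
  simp only [Finset.sum_const, Finset.card_univ, Fintype.card_fin, smul_eq_mul, mul_one,
    Fintype.card_sum, Fintype.card_prod, Fintype.card_bool] at hcard
  exact ⟨G, hG, by lia⟩

theorem exists_reduced_of_eq {n k : ℕ} (hn : 2 ≤ n) {s : Fin k → ℕ} (hs : ∀ j, 1 ≤ s j)
    (h : n = ∑ j, s j) : ∃ G : MarkedGraph n s, (∀ e, ¬ G.IsSeparating e) ∧
      G.polysimplexDim + (Finset.univ.filter fun j => s j = 1).card + 2 = 2 * k := by
  obtain ⟨t, rfl⟩ : ∃ t, s = fun j => t j + 1 :=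
    ⟨fun j => s j - 1, funext fun j => (Nat.sub_add_cancel (hs j)).symm⟩
  obtain ⟨G, hG, hcard⟩ : ∃ G : MarkedGraph n fun j => t j + 1, (∀ e, ¬ G.IsSeparating e) ∧
      Fintype.card G.E + (Finset.univ.filter fun j => t j + 1 = 1).card + 2 =
        ∑ j, t j + 3 * k := by
    match k with
    | 0 => simp [h] at hn
    | 1 => exact exists_card_edges_eq_of_one_wedge hn h
    | k + 2 => exact h ▸ exists_card_edges_eq_of_two_le_wedges t
  refine ⟨G, hG, ?_⟩
  have hdim := G.polysimplexDim_of_outside_eq_empty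
    (G.outside_eq_empty_of_forall_not_isSeparating h hG)
  have hsum : ∑ j, (t j + 1) = ∑ j, t j + k := by simp [Finset.sum_add_distrib]
  lia

theorem exists_reduced_of_lt {n k : ℕ} (hn : 2 ≤ n) {s : Fin k → ℕ} (hs : ∀ j, 1 ≤ s j)
    (h : ∑ j, s j < n) : ∃ G : MarkedGraph n s, (∀ e, ¬ G.IsSeparating e) ∧
      G.polysimplexDim + 3 * ∑ j, s j + (Finset.univ.filter fun j => s j = 1).card + 4 =
        3 * n + 3 * k := by
  obtain ⟨t, rfl⟩ : ∃ t, s = fun j => t j + 1 :=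
    ⟨fun j => s j - 1, funext fun j => (Nat.sub_add_cancel (hs j)).symm⟩
  obtain ⟨b, rfl⟩ : ∃ b, n = ∑ j, (t j + 1) + b + 1 := ⟨n - ∑ j, (t j + 1) - 1, by lia⟩
  have hne : k + b ≠ 0 := fun h0 => by
    obtain ⟨rfl, rfl⟩ := Nat.add_eq_zero_iff.mp h0
    simp at hn
  obtain ⟨G, hG, hcard⟩ := exists_card_edges_eq_of_lt_rank t b hne
  have hdim := G.polysimplexDim_of_outside_nonempty (G.outside_nonempty hs h)
  have hsum : ∑ j, (t j + 1) = ∑ j, t j + k := by simp [Finset.sum_add_distrib]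
  exact ⟨G, hG, by lia⟩

end RelOuter

theorem mainTheorem7 (n k : ℕ) (hn : 2 ≤ n) (s : Fin k → ℕ) (hs : ∀ j, 1 ≤ s j) (m : ℕ)
    (hm : m = (Finset.univ.filter fun j => s j = 1).card) :
    (∑ j, s j < n → ∃ d : ℕ,
      (d : ℤ) = 3 * n + 3 * k - 3 * ∑ j, (s j : ℤ) - 4 - m ∧
      RelOuter.RelOuterSpace.dim (Set.univ : Set (RelOuter.RelOuterSpace n s)) = (d : ℕ∞) ∧
      RelOuter.RelOuterSpace.dim (RelOuter.RelOuterSpace.reduced n s) = (d : ℕ∞)) ∧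
    (n = ∑ j, s j → ∃ d : ℕ,
      (d : ℤ) = 3 * n + 2 * k - 3 * ∑ j, (s j : ℤ) - 2 - m ∧
      RelOuter.RelOuterSpace.dim (RelOuter.RelOuterSpace.reduced n s) = (d : ℕ∞)) := by
  have hcast : ∑ j, (s j : ℤ) = ((∑ j, s j : ℕ) : ℤ) := (Nat.cast_sum _ _).symm
  rw [hcast]
  constructor
  · intro h
    obtain ⟨G, hG, hdim⟩ := RelOuter.exists_reduced_of_lt hn hs h
    have hmax (H : RelOuter.MarkedGraph n s) : H.polysimplexDim ≤ G.polysimplexDim := by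
      have hle := H.polysimplexDim_le hs h
      lia
    exact ⟨G.polysimplexDim, by lia,
      RelOuter.RelOuterSpace.dim_eq G (Set.subset_univ _) fun H _ => hmax H,
      RelOuter.RelOuterSpace.dim_eq G
        ((RelOuter.RelOuterSpace.openPolysimplex_subset_reduced_iff G).mpr hG) fun H _ => hmax H⟩
  · intro h
    obtain ⟨G, hG, hdim⟩ := RelOuter.exists_reduced_of_eq hn hs h
    have hk : Nonempty (Fin k) := Fin.pos_iff_nonempty.mp <| Nat.pos_of_ne_zero fun hk => by
      subst hk
      simp [h] at hn
    refine ⟨G.polysimplexDim, by lia, RelOuter.RelOuterSpace.dim_eq G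
      ((RelOuter.RelOuterSpace.openPolysimplex_subset_reduced_iff G).mpr hG) fun H hH => ?_⟩
    have hle := H.polysimplexDim_le_of_forall_not_isSeparating hs h
      ((RelOuter.RelOuterSpace.openPolysimplex_subset_reduced_iff H).mp hH)
    lia
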